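/- For a connected finite graph $G$ with vertex set $V$, the graph associahedron of $G$ is the polytope in $\mathbb{R}^V$ defined as the Minkowski sum $\sum_I \operatorname{conv}\{e_i : i\in I\}$, where $I$ ranges over all nonempty subsets of $V$ that induce a connected subgraph of $G$. A *$d$-dimensional cyclohedron* is any convex polytope whose face lattice is isomorphic to that of the graph associahedron of the cycle with $d+1$ vertices (for $d=1$, of the graph made of a single edge on two vertices). The diameter of a polytope is the diameter of its graph, that is, of the graph formed by its vertices and edges ($0$- and $1$-dimensional faces). **Corollary.** For every positive integer $d$, the graph of the $d$-dimensional cyclohedron has finite diameter (in particular, it is connected), and this diameter is at most $\lceil 5d/2\rceil-2$. -/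

import Mathlib

/-- A convex polytope: the convex hull of a finite set of points. -/
def IsPolytope {E : Type*} [AddCommGroup E] [Module ℝ E] (P : Set E) : Prop :=
  ∃ S : Set E, S.Finite ∧ P = convexHull ℝ S

/-- The faces of a convex polytope `P`, ordered by inclusion: the empty set and the subsets of `P`
on which some linear functional attains its maximum over `P` (in particular `P` itself). -/
abbrev PolytopeFace {E : Type*} [NormedAddCommGroup E] [NormedSpace ℝ E] (P : Set E) : Type _ :=
  {F : Set E // IsExposed ℝ P F}

/-- Two polytopes are combinatorially equivalent when their face lattices are isomorphic. -/
def CombinatoriallyEquivalent {E E' : Type*} [NormedAddCommGroup E] [NormedSpace ℝ E]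
    [NormedAddCommGroup E'] [NormedSpace ℝ E'] (P : Set E) (Q : Set E') : Prop :=
  Nonempty (PolytopeFace P ≃o PolytopeFace Q)

/-- The graph (1-skeleton) of a polytope `P`: its vertices are the points `x` such that `{x}` is a
face of `P`, and two distinct vertices are adjacent when the line segment joining them is a face
of `P`. -/
def polytopeGraph {E : Type*} [NormedAddCommGroup E] [NormedSpace ℝ E] (P : Set E) :
    SimpleGraph {x : E // IsExposed ℝ P {x}} where
  Adj u v := u ≠ v ∧ IsExposed ℝ P (segment ℝ (u : E) (v : E))
  symm := ⟨fun u v h => ⟨h.1.symm, segment_symm ℝ (u : E) (v : E) ▸ h.2⟩⟩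
  loopless := ⟨fun _ h => h.1 rfl⟩

open Classical in
/-- The tubes of a graph `G`: the nonempty sets of vertices that induce a connected subgraph. -/
noncomputable def graphTubes {V : Type*} [Fintype V] (G : SimpleGraph V) : Finset (Finset V) :=
  Finset.univ.filter fun I => (G.induce (I : Set V)).Connected

open Classical in
open scoped Pointwise in
/-- The graph associahedron of a connected graph `G` on the vertex set `V`, as a polytope in `ℝ^V`:
the Minkowski sum, over all tubes `I` of `G`, of the simplices `conv {e_i : i ∈ I}`. -/
noncomputable def graphAssociahedron {V : Type*} [Fintype V] (G : SimpleGraph V) : Set (V → ℝ) :=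
  ∑ I ∈ graphTubes G, convexHull ℝ ((fun i : V => (Pi.single i 1 : V → ℝ)) '' (I : Set V))

/-- The standard `d`-dimensional cyclohedron: the graph associahedron of the cycle with `d + 1`
vertices (for `d = 1`, this cycle is understood as the single edge on two vertices). -/
noncomputable def standardCyclohedron (d : ℕ) : Set (Fin (d + 1) → ℝ) :=
  graphAssociahedron (SimpleGraph.cycleGraph (d + 1))

/-- `P` is (a realization of) the `d`-dimensional cyclohedron: `P` is a polytope with the
combinatorial type of the standard `d`-dimensional cyclohedron. -/
def IsCyclohedron {E : Type*} [NormedAddCommGroup E] [NormedSpace ℝ E] (d : ℕ) (P : Set E) : Prop :=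
  IsPolytope P ∧ CombinatoriallyEquivalent P (standardCyclohedron d)

/-! ### Faces, vertices and edges of a polytope, read off the face lattice -/

section PolytopeFaces

variable {E : Type*} [NormedAddCommGroup E] [NormedSpace ℝ E] {P : Set E}

/-! A vertex of the Minkowski sum maximizes a functional that may be taken generic, that is, a
ranking of the vertices of the cycle; rankings under which every tube has the same top element give
the same vertex. Raising `v` past the next ranked element `p` changes only the tubes that contain
`v` and have top `p`: it follows at most one edge, and none if there is no such tube. So a longer
raise costs at most the number of dominators of `v` that are overtaken (`IsRaise.rankingDist_le`).

Fix `x` and cut the cycle open there, so that tubes avoiding `x` become intervals. From any ranking,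
bring `x` to the top, then remove the blocked elements at a cost of at most one edge each. The other
ranks now decrease on both sides of the second element `k`, so `x` and `k` determine the vertex, and
one edge moves `k` to the next position. Straightening both rankings bounds their distance by two
straightening costs plus the gap between the two second elements
(`rankingDist_le_straighteningCost`).

Finally, average over the `d + 1` choices of `x`. By double counting, `v` costs nothing at `x = v`
nor at the nearest larger elements on its two sides, so the costs of one ranking add up to at most
`d² - d + 1` (`sum_straighteningCost_le`). The gaps add up to at most `(d² + 4d - 5)/2`
(`sum_natAbs_cyclicPos_snd_sub_le`). The total is at most `(5d² - 1)/2 < (d + 1)(M + 1)` with `M =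
⌈5d/2⌉ - 2`, so some `x` gives a path of length at most `M`. Isomorphic face lattices have
isomorphic graphs, which transfers the bound to every realization. -/

theorem IsPolytope.isCompact (hP : IsPolytope P) : IsCompact P := by
  obtain ⟨S, hS, rfl⟩ := hP
  exact hS.isCompact_convexHull (𝕜 := ℝ)

theorem IsPolytope.convex (hP : IsPolytope P) : Convex ℝ P := by
  obtain ⟨S, -, rfl⟩ := hP
  exact convex_convexHull ℝ S

theorem IsPolytope.finite_extremePoints (hP : IsPolytope P) : (P.extremePoints ℝ).Finite := by
  obtain ⟨S, hS, rfl⟩ := hP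
  exact hS.subset extremePoints_convexHull_subset

/-- An extreme point of a polytope is a vertex. -/
theorem IsPolytope.isExposed_singleton (hP : IsPolytope P) {x : E} (hx : x ∈ P.extremePoints ℝ) :
    IsExposed ℝ P {x} := by
  have hconv := hP.convex
  obtain ⟨S, hS, rfl⟩ := hP
  intro _
  have hxS : x ∈ S := extremePoints_convexHull_subset hx
  have hnot : x ∉ convexHull ℝ (S \ {x}) := by
    rw [hconv.mem_extremePoints_iff_mem_sdiff_convexHull_sdiff] at hx
    exact fun h => hx.2 (convexHull_mono (Set.sdiff_subset_sdiff_left (subset_convexHull ℝ S)) h)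
  -- Strictly separating `x` from the hull of the other generators gives a functional whose only
  -- maximizer is `x`.
  obtain ⟨l, u, hl, hu⟩ := geometric_hahn_banach_closed_point (convex_convexHull ℝ _)
    ((hS.subset Set.sdiff_subset).isCompact_convexHull (𝕜 := ℝ)).isClosed hnot
  refine ⟨l, ?_⟩
  have hle : ∀ y ∈ convexHull ℝ S, l y ≤ l x := fun y hy => by
    refine convexHull_min (t := {z | l z ≤ l x}) ?_ (convex_halfSpace_le l.isLinear _) hy
    intro z hz
    by_cases hzx : z = x
    · simp [hzx]
    · exact ((hl z (subset_convexHull ℝ _ ⟨hz, hzx⟩)).trans hu).le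
  ext y
  simp only [Set.mem_singleton_iff, Set.mem_ofPred_eq]
  refine ⟨?_, fun ⟨hy, hmax⟩ => ?_⟩
  · rintro rfl
    exact ⟨hx.1, hle⟩
  · have hxy : l x ≤ l y := hmax x hx.1
    rw [← Set.insert_sdiff_self_of_mem hxS] at hy
    by_cases hne : (S \ {x}).Nonempty
    · rw [convexHull_insert hne, mem_convexJoin] at hy
      obtain ⟨a, ha, z, hz, hyz⟩ := hy
      rw [Set.mem_singleton_iff] at ha
      subst ha
      obtain ⟨s, t, hs, ht, hst, rfl⟩ := hyz
      have hz' := (hl z hz).trans hu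
      rw [map_add, map_smul, map_smul, smul_eq_mul, smul_eq_mul] at hxy
      have ht0 : t = 0 := by
        by_contra h
        have htpos : 0 < t := lt_of_le_of_ne ht (Ne.symm h)
        have hs' : s = 1 - t := by linarith
        subst hs'
        nlinarith
      subst ht0
      have : s = 1 := by linarith
      simp [this]
    · rw [Set.not_nonempty_iff_eq_empty.1 hne] at hy
      simpa using hy

/-- A face of a polytope is the convex hull of the extreme points it contains. -/
theorem IsPolytope.face_eq_convexHull (hP : IsPolytope P) {F : Set E} (hF : IsExposed ℝ P F) :
    F = convexHull ℝ (F.extremePoints ℝ) := by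
  have hfin : (F.extremePoints ℝ).Finite :=
    hP.finite_extremePoints.subset hF.isExtreme.extremePoints_subset_extremePoints
  rw [← (hfin.isCompact_convexHull (𝕜 := ℝ)).isClosed.closure_eq]
  exact (closure_convexHull_extremePoints (hF.isCompact hP.isCompact) (hF.convex hP.convex)).symm

theorem IsPolytope.exists_vertex_mem_face (hP : IsPolytope P) {F : Set E} (hF : IsExposed ℝ P F)
    (hne : F.Nonempty) : ∃ x ∈ F, IsExposed ℝ P {x} := by
  obtain ⟨x, hx⟩ := (hF.isCompact hP.isCompact).extremePoints_nonempty hne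
  exact ⟨x, hx.1, hP.isExposed_singleton
    (hF.isExtreme.extremePoints_subset_extremePoints hx)⟩

/-- The empty face is the least face. -/
instance PolytopeFace.instOrderBot : OrderBot (PolytopeFace P) where
  bot := ⟨∅, isExposed_empty⟩
  bot_le F := Set.empty_subset F.1

/-- The face consisting of a single vertex. -/
def vertexFace (u : {x : E // IsExposed ℝ P {x}}) : PolytopeFace P := ⟨{u.1}, u.2⟩

theorem vertexFace_le_iff (u : {x : E // IsExposed ℝ P {x}}) (F : PolytopeFace P) :
    vertexFace u ≤ F ↔ u.1 ∈ F.1 :=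
  Set.singleton_subset_iff

theorem vertexFace_injective : Function.Injective (vertexFace (P := P)) := fun _ _ h =>
  Subtype.ext (Set.singleton_injective (congrArg Subtype.val h))

theorem isAtom_vertexFace (u : {x : E // IsExposed ℝ P {x}}) : IsAtom (vertexFace u) := by
  refine ⟨fun h => ?_, fun F hF => ?_⟩
  · exact Set.singleton_ne_empty u.1 (congrArg Subtype.val h)
  · have hlt : F.1 ⊂ {u.1} := hF
    exact Subtype.ext (Set.ssubset_singleton_iff.1 hlt)

/-- Every nonempty face contains a vertex, so the atoms of the face lattice are exactly the
vertices; a lattice isomorphism therefore maps vertices to vertices. -/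
theorem IsPolytope.exists_vertexFace_eq (hP : IsPolytope P) {F : PolytopeFace P} (hF : IsAtom F) :
    ∃ u, vertexFace u = F := by
  have hne : F.1.Nonempty := by
    rw [Set.nonempty_iff_ne_empty]
    exact fun h => hF.1 (Subtype.ext h)
  obtain ⟨x, hxF, hx⟩ := hP.exists_vertex_mem_face F.2 hne
  have hle : vertexFace ⟨x, hx⟩ ≤ F := (vertexFace_le_iff _ _).2 hxF
  exact ⟨⟨x, hx⟩, (hF.le_iff.1 hle).resolve_left (isAtom_vertexFace _).1⟩

/-- Adjacency in the graph of a polytope, in terms of the order on the faces. -/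
theorem IsPolytope.adj_iff (hP : IsPolytope P) (u v : {x : E // IsExposed ℝ P {x}}) :
    (polytopeGraph P).Adj u v ↔
      u ≠ v ∧ ∃ F : PolytopeFace P, ∀ z, vertexFace z ≤ F ↔ z = u ∨ z = v := by
  refine and_congr_right fun huv => ⟨fun h => ⟨⟨_, h⟩, fun z => ?_⟩, fun ⟨F, hF⟩ => ?_⟩
  · rw [vertexFace_le_iff]
    constructor
    · intro hz
      have hzext : z.1 ∈ P.extremePoints ℝ :=
        isExtreme_singleton.1 z.2.isExtreme
      have := mem_extremePoints_iff_forall_segment.1 hzext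
      have h' := this.2 u.1 (u.2.subset rfl) v.1 (v.2.subset rfl) hz
      rcases h' with h' | h'
      · exact Or.inl (Subtype.ext h'.symm)
      · exact Or.inr (Subtype.ext h'.symm)
    · rintro (rfl | rfl)
      · exact left_mem_segment ℝ _ _
      · exact right_mem_segment ℝ _ _
  · have hu : u.1 ∈ F.1 := (vertexFace_le_iff _ _).1 ((hF u).2 (Or.inl rfl))
    have hv : v.1 ∈ F.1 := (vertexFace_le_iff _ _).1 ((hF v).2 (Or.inr rfl))
    have hseg : segment ℝ u.1 v.1 = F.1 := by
      refine Set.Subset.antisymm ((F.2.convex hP.convex).segment_subset hu hv) ?_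
      rw [hP.face_eq_convexHull F.2, ← convexHull_pair]
      refine convexHull_mono fun x hx => ?_
      have hxP := hP.isExposed_singleton (F.2.isExtreme.extremePoints_subset_extremePoints hx)
      have hxF : vertexFace ⟨x, hxP⟩ ≤ F := (vertexFace_le_iff _ _).2 hx.1
      rcases (hF _).1 hxF with h | h
      · exact Or.inl (congrArg Subtype.val h)
      · exact Or.inr (congrArg Subtype.val h)
    rw [hseg]
    exact F.2

variable {E' : Type*} [NormedAddCommGroup E'] [NormedSpace ℝ E'] {Q : Set E'}

/-- Combinatorially equivalent polytopes have isomorphic graphs. -/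
theorem CombinatoriallyEquivalent.nonempty_graphIso (hP : IsPolytope P) (hQ : IsPolytope Q)
    (h : CombinatoriallyEquivalent P Q) : Nonempty (polytopeGraph P ≃g polytopeGraph Q) := by
  obtain ⟨e⟩ := h
  have hf : ∀ u, ∃ u', vertexFace u' = e (vertexFace u) := fun u =>
    hQ.exists_vertexFace_eq ((e.isAtom_iff _).2 (isAtom_vertexFace u))
  choose f hf using hf
  have hbij : Function.Bijective f := by
    constructor
    · intro u v huv
      have := hf u
      rw [huv, hf v] at this
      exact (vertexFace_injective (e.injective this)).symm
    · intro w
      obtain ⟨u, hu⟩ := hP.exists_vertexFace_eq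
        ((e.symm.isAtom_iff _).2 (isAtom_vertexFace w))
      refine ⟨u, vertexFace_injective ?_⟩
      rw [hf, hu, e.apply_symm_apply]
  refine ⟨⟨Equiv.ofBijective f hbij, fun {u v} => ?_⟩⟩
  rw [hP.adj_iff, hQ.adj_iff]
  refine and_congr hbij.1.ne_iff ⟨fun ⟨F, hF⟩ => ⟨e.symm F, fun z => ?_⟩,
    fun ⟨F, hF⟩ => ⟨e F, fun z => ?_⟩⟩
  · rw [e.le_symm_apply, ← hf, hF]
    exact or_congr hbij.1.eq_iff hbij.1.eq_iff
  · obtain ⟨z, rfl⟩ := hbij.2 z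
    rw [hf, e.le_iff_le, hF]
    exact (or_congr hbij.1.eq_iff hbij.1.eq_iff).symm

end PolytopeFaces

theorem SimpleGraph.Iso.ediam_le {V W : Type*} {G : SimpleGraph V} {H : SimpleGraph W}
    (f : G ≃g H) : G.ediam ≤ H.ediam := by
  refine SimpleGraph.ediam_le_of_edist_le fun u v => ?_
  refine le_trans ?_ (SimpleGraph.edist_le_ediam (u := f u) (v := f v))
  refine le_iInf fun p => ?_
  have hp := SimpleGraph.edist_le (p.map f.symm.toHom)
  simpa using hp

/-! ### Minkowski sums of simplices: maximizers and edges -/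

section SimplexSum

open scoped Pointwise

variable {V : Type*} [Fintype V] {T : Finset (Finset V)}

open Classical in
/-- The Minkowski sum of the faces of the standard simplex indexed by a family of sets. -/
noncomputable def simplexSum (T : Finset (Finset V)) : Set (V → ℝ) :=
  ∑ I ∈ T, convexHull ℝ ((fun i : V => (Pi.single i 1 : V → ℝ)) '' (I : Set V))

omit [Fintype V] in
theorem isPolytope_simplexSum (T : Finset (Finset V)) : IsPolytope (simplexSum T) := by
  classical
  refine ⟨∑ I ∈ T, (fun i : V => (Pi.single i 1 : V → ℝ)) '' (I : Set V), ?_, ?_⟩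
  · have : ∀ T' : Finset (Finset V),
        (∑ I ∈ T', (fun i : V => (Pi.single i 1 : V → ℝ)) '' (I : Set V)).Finite := by
      intro T'
      induction T' using Finset.induction_on with
      | empty => simp
      | insert I T' hI ih =>
        rw [Finset.sum_insert hI]
        exact (I.finite_toSet.image _).add ih
    exact this T
  · rw [simplexSum, convexHull_sum]

/-- The linear functional with the given values on the standard basis. -/
noncomputable def weightFunctional (w : V → ℝ) : StrongDual ℝ (V → ℝ) :=
  ∑ i, w i • ContinuousLinearMap.proj (R := ℝ) (φ := fun _ : V => ℝ) i

theorem weightFunctional_apply (w y : V → ℝ) : weightFunctional w y = ∑ i, w i * y i := by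
  simp [weightFunctional]

open Classical in
theorem weightFunctional_single (w : V → ℝ) (i : V) :
    weightFunctional w (Pi.single i 1) = w i := by
  simp [weightFunctional_apply, Pi.single_apply]

open Classical in
theorem eq_weightFunctional (l : StrongDual ℝ (V → ℝ)) :
    l = weightFunctional fun i => l (Pi.single i 1) := by
  ext y
  rw [weightFunctional_apply, ← Finset.univ_sum_single y, map_sum]
  refine Finset.sum_congr rfl fun i _ => ?_
  have : (Pi.single i (y i) : V → ℝ) = y i • Pi.single i 1 := by
    rw [← Pi.single_smul, smul_eq_mul, mul_one]
  rw [this, map_smul, smul_eq_mul, mul_comm]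
  congr 1
  simp [Pi.single_apply]

open Classical in
/-- The sum of the basis vectors selected by a choice function on the sets of the family. -/
noncomputable def selectionPoint (T : Finset (Finset V)) (m : Finset V → V) : V → ℝ :=
  ∑ I ∈ T, Pi.single (m I) 1

omit [Fintype V] in
theorem selectionPoint_mem {m : Finset V → V} (hm : ∀ I ∈ T, m I ∈ I) :
    selectionPoint T m ∈ simplexSum T := by
  classical
  refine Set.finsetSum_mem_finsetSum _ _ _ fun I hI => subset_convexHull ℝ _ ?_
  exact ⟨m I, hm I hI, rfl⟩

omit [Fintype V] in
theorem selectionPoint_congr {m m' : Finset V → V} (h : ∀ I ∈ T, m I = m' I) :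
    selectionPoint T m = selectionPoint T m' :=
  Finset.sum_congr rfl fun I hI => by rw [h I hI]

open Classical in
theorem mem_convexHull_single_image {I : Finset V} {y : V → ℝ}
    (hy : y ∈ convexHull ℝ ((fun i : V => (Pi.single i 1 : V → ℝ)) '' (I : Set V))) :
    (∀ i, 0 ≤ y i) ∧ (∀ i ∉ I, y i = 0) ∧ ∑ i, y i = 1 := by
  have hconv : Convex ℝ {y : V → ℝ | (∀ i, 0 ≤ y i) ∧ (∀ i ∉ I, y i = 0) ∧ ∑ i, y i = 1} := by
    intro a ha b hb s t hs ht hst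
    refine ⟨fun i => ?_, fun i hi => ?_, ?_⟩
    · have := ha.1 i
      have := hb.1 i
      simp only [Pi.add_apply, Pi.smul_apply, smul_eq_mul]
      positivity
    · simp [ha.2.1 i hi, hb.2.1 i hi]
    · simp only [Pi.add_apply, Pi.smul_apply, smul_eq_mul, Finset.sum_add_distrib,
        ← Finset.mul_sum, ha.2.2, hb.2.2, mul_one, hst]
  refine convexHull_min ?_ hconv hy
  rintro _ ⟨i, hi, rfl⟩
  refine ⟨fun j => ?_, fun j hj => ?_, ?_⟩
  · simp only [Pi.single_apply]
    split_ifs <;> simp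
  · have : j ≠ i := fun h => hj (h ▸ hi)
    simp [this]
  · simp [Pi.single_apply]

/-- The bound holds summand by summand: a point of the simplex on `I` is a weighted mean, so its
`w`-value is at most the maximum of `w` on `I`. -/
theorem weightFunctional_le {w : V → ℝ} {m : Finset V → V}
    (hmax : ∀ I ∈ T, ∀ z ∈ I, w z ≤ w (m I)) {y : V → ℝ} (hy : y ∈ simplexSum T) :
    weightFunctional w y ≤ weightFunctional w (selectionPoint T m) := by
  classical
  obtain ⟨g, hg, rfl⟩ := (Set.mem_finsetSum _ _ _).1 hy
  rw [selectionPoint, map_sum, map_sum]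
  refine Finset.sum_le_sum fun I hI => ?_
  obtain ⟨h0, hI0, h1⟩ := mem_convexHull_single_image (hg hI)
  rw [weightFunctional_single, weightFunctional_apply, ← mul_one (w (m I)), ← h1, Finset.mul_sum]
  refine Finset.sum_le_sum fun i _ => ?_
  by_cases hi : i ∈ I
  · exact mul_le_mul_of_nonneg_right (hmax I hI i hi) (h0 i)
  · simp [hI0 i hi]

/-- If the maximum of `w` on each set is attained only at `m₁ I` and `m₂ I`, and these two elements
are equal or are the same two elements for all sets, then the face maximizing `w` is a segment. -/
theorem isExposed_segment_selectionPoint {w : V → ℝ} {m₁ m₂ : Finset V → V} {a b : V}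
    (h₁ : ∀ I ∈ T, m₁ I ∈ I) (h₂ : ∀ I ∈ T, m₂ I ∈ I)
    (hw : ∀ I ∈ T, w (m₂ I) = w (m₁ I)) (hmax : ∀ I ∈ T, ∀ z ∈ I, w z ≤ w (m₁ I))
    (huniq : ∀ I ∈ T, ∀ z ∈ I, w z = w (m₁ I) → z = m₁ I ∨ z = m₂ I)
    (hab : ∀ I ∈ T, m₁ I = m₂ I ∨ m₁ I = a ∧ m₂ I = b) :
    IsExposed ℝ (simplexSum T) (segment ℝ (selectionPoint T m₁) (selectionPoint T m₂)) := by
  classical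
  intro _
  refine ⟨weightFunctional w, ?_⟩
  have heq : weightFunctional w (selectionPoint T m₂) = weightFunctional w (selectionPoint T m₁) := by
    simp only [selectionPoint, map_sum, weightFunctional_single]
    exact Finset.sum_congr rfl hw
  ext y
  constructor
  · rintro ⟨s, t, hs, ht, hst, rfl⟩
    refine ⟨(isPolytope_simplexSum T).convex (selectionPoint_mem h₁) (selectionPoint_mem h₂)
      hs ht hst, fun z hz => ?_⟩
    rw [map_add, map_smul, map_smul, heq, ← add_smul, hst, one_smul]
    exact weightFunctional_le hmax hz
  · rintro ⟨hy, hopt⟩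
    have hge := hopt _ (selectionPoint_mem h₁)
    obtain ⟨g, hg, rfl⟩ := (Set.mem_finsetSum _ _ _).1 hy
    rw [selectionPoint, map_sum, map_sum] at hge
    have hgI := fun I (hI : I ∈ T) => mem_convexHull_single_image (hg hI)
    have hle : ∀ I ∈ T, ∀ i ∈ Finset.univ, w i * g I i ≤ w (m₁ I) * g I i := by
      intro I hI i _
      obtain ⟨h0, hI0, -⟩ := hgI I hI
      by_cases hi : i ∈ I
      · exact mul_le_mul_of_nonneg_right (hmax I hI i hi) (h0 i)
      · simp [hI0 i hi]
    have hbound : ∀ I ∈ T, weightFunctional w (g I) ≤ weightFunctional w (Pi.single (m₁ I) 1) := by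
      intro I hI
      rw [weightFunctional_single, weightFunctional_apply, ← mul_one (w (m₁ I)), ← (hgI I hI).2.2,
        Finset.mul_sum]
      exact Finset.sum_le_sum (hle I hI)
    -- A sum of termwise inequalities is tight only if every term is.
    have htight : ∀ I ∈ T, weightFunctional w (g I) = weightFunctional w (Pi.single (m₁ I) 1) :=
      (Finset.sum_eq_sum_iff_of_le hbound).1 (le_antisymm (Finset.sum_le_sum hbound) hge)
    have hsupp : ∀ I ∈ T, ∀ i, i ≠ m₁ I → i ≠ m₂ I → g I i = 0 := by
      intro I hI i hi₁ hi₂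
      have h := htight I hI
      rw [weightFunctional_single, weightFunctional_apply, ← mul_one (w (m₁ I)),
        ← (hgI I hI).2.2, Finset.mul_sum] at h
      have h' := (Finset.sum_eq_sum_iff_of_le (hle I hI)).1 h i (Finset.mem_univ i)
      by_contra hne
      have hiI : i ∈ I := by
        by_contra hiI
        exact hne ((hgI I hI).2.1 i hiI)
      rcases huniq I hI i hiI (mul_right_cancel₀ hne h') with h | h
      · exact hi₁ h
      · exact hi₂ h
    -- Each summand is either forced or lies on the edge from `e_a` to `e_b`. All the free summands
    -- share this one direction, so the maximizing face is a segment and not something of higher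
    -- dimension.
    have hform : ∀ I ∈ T, g I = Pi.single (m₁ I) 1 + (if m₁ I = m₂ I then 0 else g I b) •
        (Pi.single b 1 - Pi.single a 1 : V → ℝ) := by
      intro I hI
      have hsum := (hgI I hI).2.2
      by_cases h : m₁ I = m₂ I
      · have hother : ∀ i, i ≠ m₁ I → g I i = 0 := fun i hi => hsupp I hI i hi (h ▸ hi)
        rw [Finset.sum_eq_single (m₁ I) (fun i _ hi => hother i hi) (by simp)] at hsum
        rw [if_pos h, zero_smul, add_zero]
        ext i
        by_cases hi : i = m₁ I
        · rw [hi, hsum, Pi.single_eq_same]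
        · rw [hother i hi, Pi.single_eq_of_ne hi]
      · obtain ⟨ha, hb⟩ := (hab I hI).resolve_left h
        have hne : a ≠ b := fun hh => h (by rw [ha, hb, hh])
        have hsum' : g I a + g I b = 1 := by
          rw [← hsum, ← Finset.sum_pair hne]
          refine Finset.sum_subset (Finset.subset_univ _) fun i _ hi => ?_
          rw [Finset.mem_insert, Finset.mem_singleton, not_or] at hi
          exact hsupp I hI i (ha ▸ hi.1) (hb ▸ hi.2)
        ext i
        rw [if_neg h, ha]
        simp only [Pi.add_apply, Pi.smul_apply, Pi.sub_apply, smul_eq_mul, Pi.single_apply]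
        by_cases hia : i = a
        · subst hia
          simp only [if_true, if_neg hne]
          linarith
        · by_cases hib : i = b
          · subst hib
            simp [hia]
          · simp [hia, hib, hsupp I hI i (ha ▸ hia) (hb ▸ hib)]
    have hm₂ : selectionPoint T m₂ = selectionPoint T m₁ +
        ((T.filter fun I => m₁ I ≠ m₂ I).card : ℝ) • (Pi.single b 1 - Pi.single a 1 : V → ℝ) := by
      rw [Finset.card_filter, Nat.cast_sum, Finset.sum_smul, selectionPoint, selectionPoint,
        ← Finset.sum_add_distrib]
      refine Finset.sum_congr rfl fun I hI => ?_
      by_cases h : m₁ I = m₂ I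
      · simp [h]
      · obtain ⟨ha, hb⟩ := (hab I hI).resolve_left h
        rw [if_pos h, Nat.cast_one, one_smul, ha, hb, add_sub_cancel]
    have hgsum : ∑ I ∈ T, g I = selectionPoint T m₁ +
        (∑ I ∈ T with m₁ I ≠ m₂ I, g I b) • (Pi.single b 1 - Pi.single a 1 : V → ℝ) := by
      rw [Finset.sum_filter, Finset.sum_smul, selectionPoint, ← Finset.sum_add_distrib]
      refine Finset.sum_congr rfl fun I hI => ?_
      have hI' := hform I hI
      by_cases h : m₁ I = m₂ I
      · rw [if_pos h, zero_smul] at hI'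
        rw [if_neg (not_not.2 h), zero_smul, hI']
      · rw [if_neg h] at hI'
        rw [if_pos h, ← hI']
    rw [hgsum, hm₂]
    set N := T.filter fun I => m₁ I ≠ m₂ I with hN
    have hs0 : 0 ≤ ∑ I ∈ N, g I b :=
      Finset.sum_nonneg fun I hI => (hgI I (Finset.mem_filter.1 hI).1).1 b
    have hsN : ∑ I ∈ N, g I b ≤ N.card := by
      rw [← nsmul_one, ← Finset.sum_const]
      refine Finset.sum_le_sum fun I hI => ?_
      obtain ⟨h0, -, h1⟩ := hgI I (Finset.mem_filter.1 hI).1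
      rw [← h1]
      exact Finset.single_le_sum (fun i _ => h0 i) (Finset.mem_univ b)
    rcases N.eq_empty_or_nonempty with h | h
    · simp [h]
    · have hpos : (0 : ℝ) < N.card := by exact_mod_cast h.card_pos
      rw [segment_eq_image']
      refine ⟨(∑ I ∈ N, g I b) / N.card, ⟨by positivity, (div_le_one hpos).2 hsN⟩, ?_⟩
      simp only [add_sub_cancel_left, smul_smul]
      rw [div_mul_cancel₀ _ hpos.ne']

end SimplexSum

/-! ### Rankings as vertices, and the cost of raising one element -/

section Rankings

variable {V : Type*} [Fintype V] [Nonempty V] {T : Finset (Finset V)}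

open Classical in
/-- An element of `I` of the largest rank. -/
noncomputable def topElement (w : V → ℝ) (I : Finset V) : V :=
  if h : I.Nonempty then (I.exists_max_image w h).choose else Classical.arbitrary V

omit [Fintype V] in
theorem topElement_mem (w : V → ℝ) {I : Finset V} (h : I.Nonempty) : topElement w I ∈ I := by
  rw [topElement, dif_pos h]
  exact (I.exists_max_image w h).choose_spec.1

omit [Fintype V] in
theorem le_topElement (w : V → ℝ) {I : Finset V} {z : V} (hz : z ∈ I) :
    w z ≤ w (topElement w I) := by
  have h : I.Nonempty := ⟨z, hz⟩
  rw [topElement, dif_pos h]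
  exact (I.exists_max_image w h).choose_spec.2 z hz

omit [Fintype V] in
theorem topElement_eq (w : V ↪ ℝ) {I : Finset V} {i : V} (hi : i ∈ I) (h : ∀ z ∈ I, w z ≤ w i) :
    topElement w I = i :=
  w.injective (le_antisymm (h _ (topElement_mem w ⟨i, hi⟩)) (le_topElement w hi))

/-- The vertex of the Minkowski sum that maximizes a ranking. -/
noncomputable def rankingVertex (hT : ∀ I ∈ T, I.Nonempty) (w : V ↪ ℝ) :
    {x : V → ℝ // IsExposed ℝ (simplexSum T) {x}} :=
  ⟨selectionPoint T (topElement w), by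
    rw [← segment_same ℝ]
    exact isExposed_segment_selectionPoint (w := w) (a := Classical.arbitrary V)
      (b := Classical.arbitrary V) (fun I hI => topElement_mem w (hT I hI))
      (fun I hI => topElement_mem w (hT I hI)) (fun _ _ => rfl)
      (fun I _ z hz => le_topElement w hz) (fun I _ z _ h => Or.inl (w.injective h))
      (fun _ _ => Or.inl rfl)⟩

theorem rankingVertex_congr (hT : ∀ I ∈ T, I.Nonempty) {w w' : V ↪ ℝ}
    (h : ∀ I ∈ T, topElement w I = topElement w' I) : rankingVertex hT w = rankingVertex hT w' :=
  Subtype.ext (selectionPoint_congr h)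

-- Ties of `w₀` are broken by an arbitrary enumeration of `V`; the rank of an element counts the
-- elements with a smaller lexicographic key.
omit [Nonempty V] in
theorem exists_ranking_refining (w₀ : V → ℝ) : ∃ w : V ↪ ℝ, ∀ i j, w₀ i < w₀ j → w i < w j := by
  classical
  let key : V → ℝ ×ₗ Fin (Fintype.card V) := fun i => toLex (w₀ i, Fintype.equivFin V i)
  have hkey : Function.Injective key := fun i j h => by
    have h2 := congrArg (fun p => (ofLex p).2) h
    exact (Fintype.equivFin V).injective h2
  let r : V → ℝ := fun i => ((Finset.univ.filter fun j => key j < key i).card : ℝ)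
  have hr : ∀ i j, key i < key j → r i < r j := by
    intro i j h
    refine Nat.cast_lt.2 (Finset.card_lt_card (Finset.ssubset_iff_of_subset ?_ |>.2 ⟨i, ?_, ?_⟩))
    · intro z hz
      simp only [Finset.mem_filter, Finset.mem_univ, true_and] at hz ⊢
      exact hz.trans h
    · simpa using h
    · simp
  refine ⟨⟨r, fun i j h => ?_⟩, fun i j h => hr i j ?_⟩
  · by_contra hne
    rcases lt_or_gt_of_ne (hkey.ne hne) with h' | h'
    · exact (hr _ _ h').ne h
    · exact (hr _ _ h').ne' h
  · exact Prod.Lex.toLex_lt_toLex.2 (Or.inl h)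

/-- Break the ties of a functional that exposes the vertex: the top elements of the refined ranking
still maximize the functional, so they select the same point. -/
theorem exists_rankingVertex_eq (hT : ∀ I ∈ T, I.Nonempty)
    (u : {x : V → ℝ // IsExposed ℝ (simplexSum T) {x}}) : ∃ w, rankingVertex hT w = u := by
  classical
  obtain ⟨x, hx⟩ := u
  obtain ⟨l, hl⟩ := hx ⟨x, rfl⟩
  obtain ⟨w, hw⟩ := exists_ranking_refining fun i => l (Pi.single i 1)
  refine ⟨w, Subtype.ext ?_⟩
  have hmem : selectionPoint T (topElement w) ∈ simplexSum T :=
    selectionPoint_mem fun I hI => topElement_mem w (hT I hI)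
  have : selectionPoint T (topElement w) ∈ ({x} : Set (V → ℝ)) := by
    rw [hl]
    refine ⟨hmem, fun y hy => ?_⟩
    rw [eq_weightFunctional l]
    refine weightFunctional_le (fun I _ z hz => ?_) hy
    by_contra hlt
    exact (le_topElement w hz).not_gt (hw _ _ (not_le.1 hlt))
  exact this

/-- The distance between the vertices given by two rankings. -/
noncomputable def rankingDist (hT : ∀ I ∈ T, I.Nonempty) (w w' : V ↪ ℝ) : ℕ∞ :=
  (polytopeGraph (simplexSum T)).edist (rankingVertex hT w) (rankingVertex hT w')

theorem rankingDist_triangle (hT : ∀ I ∈ T, I.Nonempty) (w₁ w₂ w₃ : V ↪ ℝ) :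
    rankingDist hT w₁ w₃ ≤ rankingDist hT w₁ w₂ + rankingDist hT w₂ w₃ :=
  SimpleGraph.edist_triangle

theorem rankingDist_comm (hT : ∀ I ∈ T, I.Nonempty) (w w' : V ↪ ℝ) :
    rankingDist hT w w' = rankingDist hT w' w :=
  SimpleGraph.edist_comm

theorem rankingDist_eq_zero (hT : ∀ I ∈ T, I.Nonempty) {w w' : V ↪ ℝ}
    (h : ∀ I ∈ T, topElement w I = topElement w' I) : rankingDist hT w w' = 0 :=
  SimpleGraph.edist_eq_zero_iff.2 (rankingVertex_congr hT h)

/-- `w'` is obtained from the ranking `w` by raising the rank of `v` to `t`. -/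
structure IsRaise (w : V ↪ ℝ) (v : V) (t : ℝ) (w' : V ↪ ℝ) : Prop where
  lt : w v < t
  self : w' v = t
  other : ∀ z, z ≠ v → w' z = w z

omit [Fintype V] [Nonempty V] in
theorem exists_isRaise (w : V ↪ ℝ) {v : V} {t : ℝ} (hlt : w v < t) (ht : ∀ z, w z ≠ t) :
    ∃ w', IsRaise w v t w' := by
  classical
  refine ⟨⟨Function.update w v t, fun a b h => ?_⟩, hlt, ?_, fun z hz => ?_⟩
  · by_cases ha : a = v <;> by_cases hb : b = v
    · rw [ha, hb]
    · subst ha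
      rw [Function.update_self, Function.update_of_ne hb] at h
      exact absurd h.symm (ht b)
    · subst hb
      rw [Function.update_self, Function.update_of_ne ha] at h
      exact absurd h (ht a)
    · rw [Function.update_of_ne ha, Function.update_of_ne hb] at h
      exact w.injective h
  · exact Function.update_self v t w
  · exact Function.update_of_ne hz t w

-- Supplies target ranks for raises: moving to `t` overtakes the element of rank `c` and nothing
-- ranked above it.
omit [Nonempty V] in
theorem exists_rank_just_above (w : V ↪ ℝ) (c s : ℝ) (hcs : c < s) :
    ∃ t, c < t ∧ t < s ∧ ∀ z, c < w z → t < w z := by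
  classical
  let S : Finset ℝ := insert s ((Finset.univ.image w).filter fun r => c < r)
  have hS : S.Nonempty := ⟨s, Finset.mem_insert_self _ _⟩
  have hc : c < S.min' hS := by
    rw [Finset.lt_min'_iff]
    intro r hr
    rcases Finset.mem_insert.1 hr with rfl | hr
    · exact hcs
    · exact (Finset.mem_filter.1 hr).2
  obtain ⟨t, hct, htm⟩ := exists_between hc
  refine ⟨t, hct, htm.trans_le (Finset.min'_le _ _ (Finset.mem_insert_self _ _)), fun z hz => ?_⟩
  refine htm.trans_le (Finset.min'_le _ _ (Finset.mem_insert_of_mem ?_))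
  simp [hz]

open Classical in
/-- The elements `q` ranked higher than `v` that are top elements of a set of the family
containing `v`. -/
noncomputable def dominators (T : Finset (Finset V)) (w : V ↪ ℝ) (v : V) : Finset V :=
  Finset.univ.filter fun q => w v < w q ∧ ∃ I ∈ T, v ∈ I ∧ q ∈ I ∧ ∀ z ∈ I, w z ≤ w q

omit [Nonempty V] in
theorem mem_dominators {w : V ↪ ℝ} {v q : V} :
    q ∈ dominators T w v ↔ w v < w q ∧ ∃ I ∈ T, v ∈ I ∧ q ∈ I ∧ ∀ z ∈ I, w z ≤ w q := by
  simp [dominators]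

/-- A set changes its top only if it contains `v` and its top is a dominator that `v` overtakes;
here no dominator is overtaken. -/
theorem IsRaise.rankingDist_eq_zero {w w' : V ↪ ℝ} {v : V} {t : ℝ} (h : IsRaise w v t w')
    (hT : ∀ I ∈ T, I.Nonempty) (hgap : ∀ q ∈ dominators T w v, t < w q) :
    rankingDist hT w w' = 0 := by
  refine _root_.rankingDist_eq_zero hT fun I hI => Eq.symm ?_
  have hmem := topElement_mem w (hT I hI)
  refine topElement_eq w' hmem fun z hz => ?_
  have hle := le_topElement w hz
  by_cases htop : topElement w I = v
  · rw [htop, h.self]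
    by_cases hzv : z = v
    · rw [hzv, h.self]
    · rw [h.other z hzv]
      rw [htop] at hle
      exact hle.trans h.lt.le
  · rw [h.other _ htop]
    by_cases hzv : z = v
    · rw [hzv, h.self]
      subst hzv
      refine (hgap _ (mem_dominators.2 ⟨lt_of_le_of_ne hle fun he => htop ?_, I, hI, hz, hmem,
        fun y hy => le_topElement w hy⟩)).le
      exact (w.injective he).symm
    · rwa [h.other z hzv]

/-- Here `v` overtakes only `p`, the element ranked just above it. The sets that change all switch
from `p` to `v`, so the two vertices span an edge unless they coincide. -/
theorem IsRaise.rankingDist_le_one {w w' : V ↪ ℝ} {v p : V} {t : ℝ} (h : IsRaise w v t w')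
    (hT : ∀ I ∈ T, I.Nonempty) (hvp : w v < w p) (hpt : w p < t)
    (hbelow : ∀ z, w v < w z → w p ≤ w z) (habove : ∀ z, w p < w z → t < w z) :
    rankingDist hT w w' ≤ 1 := by
  classical
  rw [rankingDist, SimpleGraph.edist_le_one_iff_adj_or_eq, or_iff_not_imp_right]
  refine fun hne => ⟨hne, ?_⟩
  have key : ∀ I ∈ T, topElement w I = p ∧ v ∈ I ∧ topElement w' I = v ∨
      topElement w' I = topElement w I ∧ (topElement w I = p → v ∉ I) := by
    intro I hI
    have hmem := topElement_mem w (hT I hI)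
    by_cases hv : v ∈ I
    · by_cases hp : topElement w I = p
      · refine Or.inl ⟨hp, hv, topElement_eq w' hv fun z hz => ?_⟩
        by_cases hzv : z = v
        · rw [hzv]
        · rw [h.self, h.other z hzv]
          exact (le_topElement w hz).trans (hp ▸ hpt.le)
      · refine Or.inr ⟨topElement_eq w' hmem fun z hz => ?_, fun hh => absurd hh hp⟩
        have hle := le_topElement w hz
        by_cases htop : topElement w I = v
        · rw [htop] at hle ⊢
          rw [h.self]
          by_cases hzv : z = v
          · rw [hzv, h.self]
          · rw [h.other z hzv]
            exact hle.trans h.lt.le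
        · rw [h.other _ htop]
          by_cases hzv : z = v
          · rw [hzv, h.self]
            have hvt : w v < w (topElement w I) :=
              lt_of_le_of_ne (le_topElement w hv) fun he => htop (w.injective he).symm
            exact (habove _ (lt_of_le_of_ne (hbelow _ hvt)
              fun he => hp (w.injective he).symm)).le
          · rwa [h.other z hzv]
    · refine Or.inr ⟨topElement_eq w' hmem fun z hz => ?_, fun _ => hv⟩
      rw [h.other z (ne_of_mem_of_not_mem hz hv), h.other _ (ne_of_mem_of_not_mem hmem hv)]
      exact le_topElement w hz
  have hpv : p ≠ v := fun hh => hvp.ne (by rw [hh])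
  -- The functional exposing the edge ties `v` with `p` and keeps all other ranks.
  have hself : Function.update w v (w p) v = w p := Function.update_self ..
  have hother : ∀ z, z ≠ v → Function.update w v (w p) z = w z :=
    fun z hz => Function.update_of_ne hz ..
  have hle : ∀ z, w z ≤ Function.update w v (w p) z := fun z => by
    by_cases hz : z = v
    · rw [hz, hself]
      exact hvp.le
    · rw [hother z hz]
  refine isExposed_segment_selectionPoint (w := Function.update w v (w p)) (a := p) (b := v)
    (fun I hI => topElement_mem w (hT I hI)) (fun I hI => topElement_mem w' (hT I hI))
    (fun I hI => ?_) (fun I hI z hz => ?_) (fun I hI z hz hzt => ?_) (fun I hI => ?_)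
  · rcases key I hI with ⟨hp, hv, hp'⟩ | ⟨he, -⟩
    · rw [hp, hp', hself, hother p hpv]
    · rw [he]
  · by_cases hzv : z = v
    · subst hzv
      rw [hself]
      by_cases htop : topElement w I = z
      · rw [htop, hself]
      · rw [hother _ htop]
        exact hbelow _ (lt_of_le_of_ne (le_topElement w hz) fun he => htop (w.injective he).symm)
    · rw [hother z hzv]
      exact (le_topElement w hz).trans (hle _)
  · by_cases hzv : z = v
    · subst hzv
      by_cases htop : topElement w I = z
      · exact Or.inl htop.symm
      · rw [hself, hother _ htop] at hzt
        rcases key I hI with ⟨-, -, hp'⟩ | ⟨-, hh⟩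
        · exact Or.inr hp'.symm
        · exact absurd hz (hh (w.injective hzt).symm)
    · rw [hother z hzv] at hzt
      by_cases htop : topElement w I = v
      · rw [htop, hself] at hzt
        have := le_topElement w hz
        rw [htop, hzt] at this
        exact absurd hvp this.not_gt
      · rw [hother _ htop] at hzt
        exact Or.inl (w.injective hzt)
  · rcases key I hI with ⟨hp, hv, hp'⟩ | ⟨he, -⟩
    · exact Or.inr ⟨hp, hp'⟩
    · exact Or.inl he.symm

open Classical in
/-- Raising `v` to rank `t` costs at most one step for each dominator of `v` of rank below `t`. -/
theorem IsRaise.rankingDist_le {w w' : V ↪ ℝ} {v : V} {t : ℝ} (h : IsRaise w v t w')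
    (hT : ∀ I ∈ T, I.Nonempty) (ht : ∀ z, w z ≠ t) :
    rankingDist hT w w' ≤ ((dominators T w v).filter fun q => w q < t).card := by
  induction hn : (Finset.univ.filter fun z => w v < w z ∧ w z < t).card using
    Nat.strong_induction_on generalizing w with
  | _ n ih =>
  subst hn
  rcases (Finset.univ.filter fun z => w v < w z ∧ w z < t).eq_empty_or_nonempty with he | hne
  · rw [h.rankingDist_eq_zero hT fun q hq => ?_]
    · exact zero_le
    · have hvq := (mem_dominators.1 hq).1
      refine lt_of_le_of_ne (not_lt.1 fun hqt => ?_) (ht q).symm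
      have : q ∈ (Finset.univ.filter fun z => w v < w z ∧ w z < t) := by simp [hvq, hqt]
      rw [he] at this
      simp at this
  · obtain ⟨p, hp, hmin⟩ := Finset.exists_min_image _ w hne
    simp only [Finset.mem_filter, Finset.mem_univ, true_and] at hp hmin
    -- Raise `v` past the next element `p` only, then induct on the number of elements left between
    -- `v` and `t`.
    obtain ⟨s, hps, hst, hs⟩ := exists_rank_just_above w (w p) t hp.2
    obtain ⟨w₁, hw₁⟩ := exists_isRaise w (hp.1.trans hps) (t := s) fun z hz => by
      rcases lt_or_ge (w p) (w z) with hh | hh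
      · exact (hs z hh).ne' hz
      · exact (hh.trans_lt hps).ne hz
    have hbelow : ∀ z, w v < w z → w p ≤ w z := fun z hz => by
      by_cases hzt : w z < t
      · exact hmin z ⟨hz, hzt⟩
      · exact hp.2.le.trans (not_lt.1 hzt)
    have h₁ : IsRaise w₁ v t w' := by
      refine ⟨hw₁.self ▸ hst, h.self, fun z hz => ?_⟩
      rw [h.other z hz, hw₁.other z hz]
    have hpv : p ≠ v := fun hh => hp.1.ne (by rw [hh])
    have hsub : ∀ z, s < w₁ z → z ≠ v ∧ w₁ z = w z ∧ w p < w z := fun z hz => by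
      have hzv : z ≠ v := by
        rintro rfl
        exact hz.ne' hw₁.self
      rw [hw₁.other z hzv] at hz
      exact ⟨hzv, hw₁.other z hzv, hps.trans hz⟩
    have ht₁ : ∀ z, w₁ z ≠ t := fun z => by
      by_cases hz : z = v
      · rw [hz, hw₁.self]
        exact hst.ne
      · rw [hw₁.other z hz]
        exact ht z
    have hcount : (Finset.univ.filter fun z => w₁ v < w₁ z ∧ w₁ z < t).card <
        (Finset.univ.filter fun z => w v < w z ∧ w z < t).card := by
      refine Finset.card_lt_card ((Finset.ssubset_iff_of_subset fun z hz => ?_).2 ⟨p, ?_, ?_⟩)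
      · simp only [Finset.mem_filter, Finset.mem_univ, true_and, hw₁.self] at hz ⊢
        obtain ⟨-, he, hh⟩ := hsub z hz.1
        exact ⟨hp.1.trans hh, he ▸ hz.2⟩
      · simp [hp]
      · simp only [Finset.mem_filter, Finset.mem_univ, true_and, hw₁.self, not_and]
        intro hh
        exact absurd (hsub p hh).2.2 (lt_irrefl _)
    have hih := ih _ hcount h₁ ht₁ rfl
    -- Raising `v` creates no dominators, and `p` is no longer one.
    have hdom : (dominators T w₁ v).filter (fun q => w₁ q < t) ⊆
        ((dominators T w v).filter fun q => w q < t).erase p := by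
      intro q hq
      obtain ⟨hq, hqt⟩ := Finset.mem_filter.1 hq
      obtain ⟨hvq, I, hI, hvI, hqI, hmax⟩ := mem_dominators.1 hq
      rw [hw₁.self] at hvq
      obtain ⟨hqv, heq, hpq⟩ := hsub q hvq
      refine Finset.mem_erase.2 ⟨fun hh => hpq.ne (by rw [hh]), Finset.mem_filter.2
        ⟨mem_dominators.2 ⟨hp.1.trans hpq, I, hI, hvI, hqI, fun z hz => ?_⟩, heq ▸ hqt⟩⟩
      by_cases hzv : z = v
      · rw [hzv]
        exact (hp.1.trans hpq).le
      · rw [← hw₁.other z hzv, ← heq]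
        exact hmax z hz
    have hcard := Finset.card_le_card hdom
    refine (rankingDist_triangle hT w w₁ w').trans ?_
    by_cases hpd : p ∈ dominators T w v
    · have hpmem : p ∈ (dominators T w v).filter fun q => w q < t :=
        Finset.mem_filter.2 ⟨hpd, hp.2⟩
      have h1 := hw₁.rankingDist_le_one hT hp.1 hps hbelow hs
      refine (add_le_add h1 hih).trans ?_
      rw [Finset.card_erase_of_mem hpmem] at hcard
      have := Finset.card_pos.2 ⟨p, hpmem⟩
      norm_cast
      omega
    · have h0 : rankingDist hT w w₁ = 0 := hw₁.rankingDist_eq_zero hT fun q hq => by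
        refine hs q (lt_of_le_of_ne (hbelow q (mem_dominators.1 hq).1) fun he => hpd ?_)
        rwa [w.injective he]
      rw [h0, zero_add]
      refine hih.trans ?_
      exact_mod_cast hcard.trans (Finset.card_le_card (Finset.erase_subset _ _))

end Rankings

/-! ### Cutting open at `x`: straightening a ranking and shifting its second element -/

section Linearized

variable {V : Type*} [Fintype V] [Nonempty V] {T : Finset (Finset V)}

/-- The sets of the family that avoid `x` are convex for the positions `pos`. -/
def ConvexAvoiding (T : Finset (Finset V)) (x : V) (pos : V → ℤ) : Prop :=
  ∀ I ∈ T, x ∉ I → ∀ a ∈ I, ∀ b ∈ I, ∀ c, pos a < pos c → pos c < pos b → c ∈ I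

open Classical in
/-- The elements other than `x` with larger elements, other than `x`, on both sides. -/
noncomputable def blockedElements (x : V) (pos : V → ℤ) (w : V ↪ ℝ) : Finset V :=
  Finset.univ.filter fun v => v ≠ x ∧ (∃ u, u ≠ x ∧ pos u < pos v ∧ w v < w u) ∧
    ∃ u, u ≠ x ∧ pos v < pos u ∧ w v < w u

/-- `x` is the top element and `k` is the top element of the others. -/
structure TopTwo (w : V ↪ ℝ) (x k : V) : Prop where
  ne : k ≠ x
  le_fst : ∀ z, w z ≤ w x
  le_snd : ∀ z, z ≠ x → w z ≤ w k

omit [Nonempty V] in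
theorem mem_blockedElements {x v : V} {pos : V → ℤ} {w : V ↪ ℝ} :
    v ∈ blockedElements x pos w ↔ v ≠ x ∧ (∃ u, u ≠ x ∧ pos u < pos v ∧ w v < w u) ∧
      ∃ u, u ≠ x ∧ pos v < pos u ∧ w v < w u := by
  simp [blockedElements]

-- Reflection of the positions, used to deduce the mirror image of an argument about left and right.
omit [Fintype V] [Nonempty V] in
theorem ConvexAvoiding.neg {x : V} {pos : V → ℤ} (h : ConvexAvoiding T x pos) :
    ConvexAvoiding T x (-pos) := fun I hI hx a ha b hb c hac hcb =>
  h I hI hx b hb a ha c (neg_lt_neg_iff.1 hcb) (neg_lt_neg_iff.1 hac)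

omit [Nonempty V] in
theorem blockedElements_neg (x : V) (pos : V → ℤ) (w : V ↪ ℝ) : blockedElements x (-pos) w = blockedElements x pos w := by
  ext v
  simp only [mem_blockedElements, Pi.neg_apply, neg_lt_neg_iff]
  tauto

-- Blockedness ignores the rank of `x`, so bringing `x` to the top leaves the blocked elements
-- unchanged.
omit [Nonempty V] in
theorem blockedElements_congr {x : V} (pos : V → ℤ) {w w' : V ↪ ℝ} (h : ∀ z, z ≠ x → w' z = w z) :
    blockedElements x pos w' = blockedElements x pos w := by
  ext v
  simp only [mem_blockedElements]
  refine and_congr_right fun hv => and_congr (exists_congr fun u => ?_) (exists_congr fun u => ?_)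
  all_goals
    refine and_congr_right fun hu => ?_
    rw [h v hv, h u hu]

/-- Moving `x` to the top. -/
theorem exists_raise_to_top (hT : ∀ I ∈ T, I.Nonempty) (w : V ↪ ℝ) (x : V) :
    ∃ w' : V ↪ ℝ, (∀ z, w' z ≤ w' x) ∧ (∀ z, z ≠ x → w' z = w z) ∧
      rankingDist hT w w' ≤ (dominators T w x).card := by
  classical
  obtain ⟨m, -, hm⟩ := Finset.exists_max_image Finset.univ w ⟨x, Finset.mem_univ x⟩
  have hlt : ∀ z, w z < w m + 1 := fun z => (hm z (Finset.mem_univ z)).trans_lt (lt_add_one _)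
  obtain ⟨w', h⟩ := exists_isRaise w (hlt x) fun z => (hlt z).ne
  refine ⟨w', fun z => ?_, h.other, ?_⟩
  · by_cases hz : z = x
    · rw [hz]
    · rw [h.other z hz, h.self]
      exact (hlt z).le
  · refine (h.rankingDist_le hT fun z => (hlt z).ne).trans ?_
    exact_mod_cast Finset.card_le_card (Finset.filter_subset _ _)

/-- Raising a blocked element `v` above the nearest larger element on its left, if that element is
smaller than the nearest larger element on its right. -/
theorem exists_raise_blocked_of_lt (hT : ∀ I ∈ T, I.Nonempty) {x k v a b : V} {pos : V → ℤ}
    (hpos : Function.Injective pos) (hconv : ConvexAvoiding T x pos) {w : V ↪ ℝ}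
    (htop : TopTwo w x k) (hv : v ∈ blockedElements x pos w)
    (hmax : ∀ z ∈ blockedElements x pos w, w z ≤ w v)
    (hax : a ≠ x) (hav : pos a < pos v) (hva : w v < w a)
    (ha : ∀ u, u ≠ x → pos u < pos v → w v < w u → pos u ≤ pos a)
    (hbx : b ≠ x) (hvb : pos v < pos b)
    (hb : ∀ u, u ≠ x → pos v < pos u → w v < w u → pos b ≤ pos u)
    (hab : w a < w b) :
    ∃ w' : V ↪ ℝ, TopTwo w' x k ∧ rankingDist hT w w' ≤ 1 ∧
      blockedElements x pos w' ⊆ blockedElements x pos w ∧ v ∉ blockedElements x pos w' := by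
  classical
  have hvx : v ≠ x := (mem_blockedElements.1 hv).1
  have hbxlt : w b < w x := lt_of_le_of_ne (htop.le_fst b) fun h => hbx (w.injective h)
  -- The rank just above `a`: `v` passes `a` but stays below `b` and `x`.
  obtain ⟨t, hat, htx, ht⟩ := exists_rank_just_above w (w a) (w x) (hab.trans hbxlt)
  have htne : ∀ z, w z ≠ t := fun z h => by
    rcases lt_or_ge (w a) (w z) with hh | hh
    · exact (ht z hh).ne' h
    · exact (hh.trans_lt hat).ne h
  have hle_of_lt : ∀ z, w z < t → w z ≤ w a := fun z hz => not_lt.1 fun hh => hz.not_gt (ht z hh)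
  have htb : t < w b := ht b hab
  obtain ⟨w', h⟩ := exists_isRaise w (hva.trans hat) htne
  have hbk : w b ≤ w k := htop.le_snd b hbx
  have hkv : k ≠ v := fun hh => (hva.trans (hab.trans_le hbk)).ne' (by rw [hh])
  -- Otherwise `a` would be blocked, with `b` on its right, against the choice of `v` as the highest
  -- blocked element.
  have ha_vis : ∀ u, u ≠ x → pos u < pos a → ¬ w a < w u := fun u hux hu hlt => by
    have : a ∈ blockedElements x pos w :=
      mem_blockedElements.2 ⟨hax, ⟨u, hux, hu, hlt⟩, ⟨b, hbx, hav.trans hvb, hab⟩⟩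
    exact (hmax a this).not_gt hva
  have hv_vis : v ∉ blockedElements x pos w' := fun hh => by
    obtain ⟨-, ⟨u, hux, hu, hlt⟩, -⟩ := mem_blockedElements.1 hh
    rw [h.self, h.other u fun e => hu.ne (by rw [e])] at hlt
    have hau : w a < w u := hat.trans hlt
    have := ha u hux hu (hva.trans hau)
    exact ha_vis u hux (lt_of_le_of_ne this fun e => hau.ne' (by rw [hpos e])) hau
  refine ⟨w', ⟨htop.ne, fun z => ?_, fun z hz => ?_⟩, ?_, fun z hz => ?_, hv_vis⟩
  · rw [h.other x hvx.symm]
    by_cases hzv : z = v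
    · rw [hzv, h.self]
      exact htx.le
    · rw [h.other z hzv]
      exact htop.le_fst z
  · rw [h.other k hkv]
    by_cases hzv : z = v
    · rw [hzv, h.self]
      exact htb.le.trans hbk
    · rw [h.other z hzv]
      exact htop.le_snd z hz
  · refine (h.rankingDist_le hT htne).trans ?_
    rw [← Nat.cast_one, Nat.cast_le]
    -- The only dominator overtaken is `a`: a set avoiding `x` that joins `v` to a farther element
    -- on the left contains `a`, and one that reaches a larger element on the right contains `b`,
    -- which is ranked too high.
    refine (Finset.card_le_card (t := {a}) fun q hq => ?_).trans (Finset.card_singleton a).le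
    obtain ⟨hq, hqt⟩ := Finset.mem_filter.1 hq
    obtain ⟨hvq, I, hI, hvI, hqI, hqmax⟩ := mem_dominators.1 hq
    have hqa := hle_of_lt q hqt
    have hxI : x ∉ I := fun hxI => (hqmax x hxI).not_gt (hqa.trans_lt (hab.trans hbxlt))
    have hqx : q ≠ x := ne_of_mem_of_not_mem hqI hxI
    rw [Finset.mem_singleton]
    rcases lt_trichotomy (pos q) (pos v) with hlt | heq | hgt
    · rcases (ha q hqx hlt hvq).lt_or_eq with hh | hh
      · have haI : a ∈ I := hconv I hI hxI q hqI v hvI a hh hav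
        exact w.injective (le_antisymm hqa (hqmax a haI))
      · exact hpos hh
    · exact absurd hvq (by rw [hpos heq]; exact lt_irrefl _)
    · have hbI : b ∈ I := by
        rcases (hb q hqx hgt hvq).lt_or_eq with hh | hh
        · exact hconv I hI hxI v hvI q hqI b hvb hh
        · rwa [hpos hh]
      exact absurd (hqmax b hbI) (hqa.trans_lt hab).not_ge
  -- No element becomes blocked: wherever the raised `v` serves as a larger element for `z`, either
  -- it already was one, or `a` or `b` replaces it on the same side.
  · have hzv : z ≠ v := fun e => hv_vis (e ▸ hz)
    obtain ⟨hzx, ⟨u₁, hu₁x, hu₁, hlt₁⟩, ⟨u₂, hu₂x, hu₂, hlt₂⟩⟩ := mem_blockedElements.1 hz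
    rw [h.other z hzv] at hlt₁ hlt₂
    refine mem_blockedElements.2 ⟨hzx, ?_, ?_⟩
    · by_cases hu₁v : u₁ = v
      · subst hu₁v
        rw [h.self] at hlt₁
        have haz := hav.trans hu₁
        exact ⟨a, hax, haz, lt_of_le_of_ne (hle_of_lt z hlt₁)
          fun e => haz.ne' (by rw [w.injective e])⟩
      · exact ⟨u₁, hu₁x, hu₁, h.other u₁ hu₁v ▸ hlt₁⟩
    · by_cases hu₂v : u₂ = v
      · subst hu₂v
        rw [h.self] at hlt₂
        have hza := hle_of_lt z hlt₂
        rcases hza.lt_or_eq with hza | hza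
        · rcases lt_or_gt_of_ne (w.injective.ne hzv) with hh | hh
          · exact ⟨u₂, hu₂x, hu₂, hh⟩
          · exact ⟨a, hax, lt_of_le_of_ne (ha z hzx hu₂ hh)
              fun e => hza.ne (by rw [hpos e]), hza⟩
        · rw [w.injective hza]
          exact ⟨b, hbx, hav.trans hvb, hab⟩
      · exact ⟨u₂, hu₂x, hu₂, h.other u₂ hu₂v ▸ hlt₂⟩

/-- Take the highest blocked element and its nearest larger elements on the two sides; up to
reflection the lower of these two is on the left. -/
theorem exists_raise_blocked (hT : ∀ I ∈ T, I.Nonempty) {x k : V} {pos : V → ℤ}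
    (hpos : Function.Injective pos) (hconv : ConvexAvoiding T x pos) {w : V ↪ ℝ}
    (htop : TopTwo w x k) (hne : (blockedElements x pos w).Nonempty) :
    ∃ w' : V ↪ ℝ, TopTwo w' x k ∧ rankingDist hT w w' ≤ 1 ∧ blockedElements x pos w' ⊂ blockedElements x pos w := by
  classical
  obtain ⟨v, hv, hmax⟩ := Finset.exists_max_image _ w hne
  obtain ⟨-, ⟨u₁, hu₁⟩, ⟨u₂, hu₂⟩⟩ := mem_blockedElements.1 hv
  obtain ⟨a, ha, hamax⟩ := Finset.exists_max_image
    (Finset.univ.filter fun u => u ≠ x ∧ pos u < pos v ∧ w v < w u) pos ⟨u₁, by simpa using hu₁⟩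
  obtain ⟨b, hb, hbmin⟩ := Finset.exists_min_image
    (Finset.univ.filter fun u => u ≠ x ∧ pos v < pos u ∧ w v < w u) pos ⟨u₂, by simpa using hu₂⟩
  simp only [Finset.mem_filter, Finset.mem_univ, true_and, and_imp] at ha hamax hb hbmin
  have hab : a ≠ b := fun e => (ha.2.1.trans hb.2.1).ne (by rw [e])
  have hfinal : ∀ w' : V ↪ ℝ, blockedElements x pos w' ⊆ blockedElements x pos w → v ∉ blockedElements x pos w' →
      blockedElements x pos w' ⊂ blockedElements x pos w := fun w' hs hv' =>
    (Finset.ssubset_iff_of_subset hs).2 ⟨v, hv, hv'⟩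
  rcases lt_or_gt_of_ne (w.injective.ne hab) with hlt | hgt
  · obtain ⟨w', h₁, h₂, h₃, h₄⟩ := exists_raise_blocked_of_lt hT hpos hconv htop hv hmax
      ha.1 ha.2.1 ha.2.2 hamax hb.1 hb.2.1 hbmin hlt
    exact ⟨w', h₁, h₂, hfinal w' h₃ h₄⟩
  · obtain ⟨w', h₁, h₂, h₃, h₄⟩ := exists_raise_blocked_of_lt hT (pos := -pos) (a := b) (b := a)
      (fun i j h => hpos (neg_injective h)) hconv.neg htop (by rwa [blockedElements_neg])
      (by rwa [blockedElements_neg]) hb.1 (neg_lt_neg hb.2.1) hb.2.2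
      (fun u hu hp hw => neg_le_neg (hbmin u hu (neg_lt_neg_iff.1 hp) hw)) ha.1 (neg_lt_neg ha.2.1)
      (fun u hu hp hw => neg_le_neg (hamax u hu (neg_lt_neg_iff.1 hp) hw)) hgt
    rw [blockedElements_neg, blockedElements_neg] at h₃
    rw [blockedElements_neg] at h₄
    exact ⟨w', h₁, h₂, hfinal w' h₃ h₄⟩

theorem exists_blockedElements_eq_empty (hT : ∀ I ∈ T, I.Nonempty) {x k : V} {pos : V → ℤ}
    (hpos : Function.Injective pos) (hconv : ConvexAvoiding T x pos) {w : V ↪ ℝ}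
    (htop : TopTwo w x k) :
    ∃ w' : V ↪ ℝ, TopTwo w' x k ∧ blockedElements x pos w' = ∅ ∧
      rankingDist hT w w' ≤ (blockedElements x pos w).card := by
  induction hn : (blockedElements x pos w).card using Nat.strong_induction_on generalizing w with
  | _ n ih =>
  subst hn
  rcases (blockedElements x pos w).eq_empty_or_nonempty with he | hne
  · exact ⟨w, htop, he, by rw [rankingDist_eq_zero hT fun _ _ => rfl]; exact zero_le⟩
  · obtain ⟨w₁, htop₁, hd₁, hss⟩ := exists_raise_blocked hT hpos hconv htop hne
    have hlt := Finset.card_lt_card hss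
    obtain ⟨w', htop', he', hd'⟩ := ih _ hlt htop₁ rfl
    refine ⟨w', htop', he', (rankingDist_triangle hT w w₁ w').trans ((add_le_add hd₁ hd').trans ?_)⟩
    norm_cast
    omega

-- Without blocked elements, ranks decrease away from `k` on both sides, so `k` decides the top of a
-- convex set. If `k` lies between `m` and `m'`, it belongs to `I` and beats `m`; if it lies
-- outside, whichever of `m` and `m'` is nearer to it would be blocked in the ranking where it
-- loses.
omit [Nonempty V] in
theorem TopTwo.max_unique_of_lt {x k m m' : V} {pos : V → ℤ} (hpos : Function.Injective pos)
    (hconv : ConvexAvoiding T x pos) {w₁ w₂ : V ↪ ℝ} (h₁ : TopTwo w₁ x k) (h₂ : TopTwo w₂ x k)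
    (he₁ : blockedElements x pos w₁ = ∅) (he₂ : blockedElements x pos w₂ = ∅) {I : Finset V} (hI : I ∈ T)
    (hx : x ∉ I) (hm : m ∈ I) (hm' : m' ∈ I) (hmax : ∀ z ∈ I, w₁ z ≤ w₁ m)
    (hmax' : ∀ z ∈ I, w₂ z ≤ w₂ m') (hlt : pos m < pos m') : False := by
  have hmm : m ≠ m' := fun e => hlt.ne (by rw [e])
  have hmx : m ≠ x := ne_of_mem_of_not_mem hm hx
  have hmx' : m' ≠ x := ne_of_mem_of_not_mem hm' hx
  have hw₁ : w₁ m' < w₁ m := lt_of_le_of_ne (hmax m' hm') (w₁.injective.ne hmm.symm)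
  have hw₂ : w₂ m < w₂ m' := lt_of_le_of_ne (hmax' m hm) (w₂.injective.ne hmm)
  rcases lt_trichotomy (pos k) (pos m) with hk | hk | hk
  · have hmk : w₂ m < w₂ k := hw₂.trans_le (h₂.le_snd m' hmx')
    have : m ∈ blockedElements x pos w₂ := mem_blockedElements.2 ⟨hmx, ⟨k, h₂.ne, hk, hmk⟩, ⟨m', hmx', hlt, hw₂⟩⟩
    simp [he₂] at this
  · have := h₂.le_snd m' hmx'
    rw [hpos hk] at this
    exact this.not_gt hw₂
  · rcases lt_trichotomy (pos k) (pos m') with hk' | hk' | hk'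
    · have hkI := hconv I hI hx m hm m' hm' k hk hk'
      have := w₁.injective (le_antisymm (hmax k hkI) (h₁.le_snd m hmx))
      exact hk.ne' (by rw [this])
    · have := h₁.le_snd m hmx
      rw [hpos hk'] at this
      exact this.not_gt hw₁
    · have hmk : w₁ m' < w₁ k := hw₁.trans_le (h₁.le_snd m hmx)
      have : m' ∈ blockedElements x pos w₁ := mem_blockedElements.2 ⟨hmx', ⟨m, hmx, hlt, hw₁⟩, ⟨k, h₁.ne, hk', hmk⟩⟩
      simp [he₁] at this

/-- Without blocked elements, the first two elements determine the vertex. -/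
theorem TopTwo.rankingDist_eq_zero (hT : ∀ I ∈ T, I.Nonempty) {x k : V} {pos : V → ℤ}
    (hpos : Function.Injective pos) (hconv : ConvexAvoiding T x pos) {w₁ w₂ : V ↪ ℝ}
    (h₁ : TopTwo w₁ x k) (h₂ : TopTwo w₂ x k)
    (he₁ : blockedElements x pos w₁ = ∅) (he₂ : blockedElements x pos w₂ = ∅) : rankingDist hT w₁ w₂ = 0 := by
  refine _root_.rankingDist_eq_zero hT fun I hI => ?_
  by_cases hx : x ∈ I
  · rw [topElement_eq w₁ hx fun z _ => h₁.le_fst z, topElement_eq w₂ hx fun z _ => h₂.le_fst z]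
  · have hm := topElement_mem w₁ (hT I hI)
    have hm' := topElement_mem w₂ (hT I hI)
    have hmax : ∀ z ∈ I, w₁ z ≤ w₁ (topElement w₁ I) := fun z hz => le_topElement w₁ hz
    have hmax' : ∀ z ∈ I, w₂ z ≤ w₂ (topElement w₂ I) := fun z hz => le_topElement w₂ hz
    rcases lt_trichotomy (pos (topElement w₁ I)) (pos (topElement w₂ I)) with h | h | h
    · exact (h₁.max_unique_of_lt hpos hconv h₂ he₁ he₂ hI hx hm hm' hmax hmax' h).elim
    · exact hpos h
    · exact (h₂.max_unique_of_lt hpos hconv h₁ he₂ he₁ hI hx hm' hm hmax' hmax h).elim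

/-- Replacing the second element by the next one. -/
theorem TopTwo.exists_shift (hT : ∀ I ∈ T, I.Nonempty) {x k k' : V} {pos : V → ℤ}
    (hpos : Function.Injective pos) (hconv : ConvexAvoiding T x pos) {w : V ↪ ℝ}
    (htop : TopTwo w x k) (he : blockedElements x pos w = ∅) (hk'x : k' ≠ x) (hkk' : pos k < pos k')
    (hnext : ∀ z, z ≠ x → pos k < pos z → pos k' ≤ pos z) :
    ∃ w' : V ↪ ℝ, TopTwo w' x k' ∧ blockedElements x pos w' = ∅ ∧ rankingDist hT w w' ≤ 1 := by
  classical
  have hkx : w k < w x := lt_of_le_of_ne (htop.le_fst k) fun h => htop.ne (w.injective h)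
  have hk'k : w k' < w k :=
    lt_of_le_of_ne (htop.le_snd k' hk'x) fun h => hkk'.ne' (by rw [w.injective h])
  -- Between `k` and `x` in rank, so that `k'` becomes the second element.
  obtain ⟨t, hkt, htx⟩ := exists_between hkx
  have hle : ∀ z, z ≠ x → w z < t := fun z hz => (htop.le_snd z hz).trans_lt hkt
  have htne : ∀ z, w z ≠ t := fun z => by
    by_cases hz : z = x
    · rw [hz]
      exact htx.ne'
    · exact (hle z hz).ne
  have hnot : ∀ z, z ∉ blockedElements x pos w := fun z => by simp [he]
  obtain ⟨w', h⟩ := exists_isRaise w (hk'k.trans hkt) htne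
  refine ⟨w', ⟨hk'x, fun z => ?_, fun z hz => ?_⟩, ?_, ?_⟩
  · rw [h.other x hk'x.symm]
    by_cases hzv : z = k'
    · rw [hzv, h.self]
      exact htx.le
    · rw [h.other z hzv]
      exact htop.le_fst z
  · by_cases hzv : z = k'
    · rw [hzv]
    · rw [h.other z hzv, h.self]
      exact (hle z hz).le
  · refine Finset.eq_empty_of_forall_notMem fun z hz => hnot z ?_
    obtain ⟨hzx, ⟨u₁, hu₁x, hu₁, hlt₁⟩, ⟨u₂, hu₂x, hu₂, hlt₂⟩⟩ := mem_blockedElements.1 hz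
    have hzk' : z ≠ k' := fun e => by
      rw [e, h.self, h.other u₁ fun e' => hu₁.ne (by rw [e', e])] at hlt₁
      exact hlt₁.not_gt (hle u₁ hu₁x)
    rw [h.other z hzk'] at hlt₁ hlt₂
    have hk_lt : ∀ z, z ≠ x → z ≠ k → w z < w k := fun z hz hzk =>
      lt_of_le_of_ne (htop.le_snd z hz) (w.injective.ne hzk)
    refine mem_blockedElements.2 ⟨hzx, ?_, ?_⟩
    · by_cases hu : u₁ = k'
      · subst hu
        have := hkk'.trans hu₁
        exact ⟨k, htop.ne, this, hk_lt z hzx fun e => this.ne (by rw [e])⟩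
      · exact ⟨u₁, hu₁x, hu₁, h.other u₁ hu ▸ hlt₁⟩
    · by_cases hu : u₂ = k'
      · subst hu
        have hzk : z ≠ k := fun e => by
          rw [h.other u₁ fun e' => (hu₁.trans hu₂).ne (by rw [e']), e] at hlt₁
          exact hlt₁.not_ge (htop.le_snd u₁ hu₁x)
        refine ⟨k, htop.ne, lt_of_le_of_ne ?_ (hpos.ne hzk), hk_lt z hzx hzk⟩
        exact not_lt.1 fun hh => hu₂.not_ge (hnext z hzx hh)
      · exact ⟨u₂, hu₂x, hu₂, h.other u₂ hu ▸ hlt₂⟩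
  · refine (h.rankingDist_le hT htne).trans ?_
    rw [← Nat.cast_one, Nat.cast_le]
    refine (Finset.card_le_card (t := {k}) fun q hq => ?_).trans (Finset.card_singleton k).le
    obtain ⟨hq, hqt⟩ := Finset.mem_filter.1 hq
    obtain ⟨hvq, I, hI, hvI, hqI, hqmax⟩ := mem_dominators.1 hq
    have hxI : x ∉ I := fun hxI => (hqmax x hxI).not_gt (hqt.trans htx)
    have hqx : q ≠ x := ne_of_mem_of_not_mem hqI hxI
    rw [Finset.mem_singleton]
    rcases lt_trichotomy (pos q) (pos k) with hlt | heq | hgt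
    · have hkI := hconv I hI hxI q hqI k' hvI k hlt hkk'
      exact w.injective (le_antisymm (htop.le_snd q hqx) (hqmax k hkI))
    · exact hpos heq
    -- A larger element to the right of `k'` would make `k'` blocked, since `k` is larger on its
    -- left.
    · refine absurd (mem_blockedElements.2 ⟨hk'x, ⟨k, htop.ne, hkk', hk'k⟩, ⟨q, hqx, ?_, hvq⟩⟩) (hnot k')
      exact lt_of_le_of_ne (hnext q hqx hgt) fun e => hvq.ne (by rw [hpos e])

/-- Positions are integers, so each shift to the next element closes the gap by at least one. -/
theorem TopTwo.rankingDist_le_of_le (hT : ∀ I ∈ T, I.Nonempty) {x k₁ k₂ : V} {pos : V → ℤ}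
    (hpos : Function.Injective pos) (hconv : ConvexAvoiding T x pos) {w₁ w₂ : V ↪ ℝ}
    (h₁ : TopTwo w₁ x k₁) (h₂ : TopTwo w₂ x k₂)
    (he₁ : blockedElements x pos w₁ = ∅) (he₂ : blockedElements x pos w₂ = ∅) (hle : pos k₁ ≤ pos k₂) :
    rankingDist hT w₁ w₂ ≤ (pos k₂ - pos k₁).toNat := by
  classical
  induction hn : (pos k₂ - pos k₁).toNat using Nat.strong_induction_on generalizing w₁ k₁ with
  | _ n ih =>
  subst hn
  rcases hle.eq_or_lt with heq | hlt
  · obtain rfl := hpos heq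
    rw [h₁.rankingDist_eq_zero hT hpos hconv h₂ he₁ he₂]
    exact zero_le
  · obtain ⟨k', hk', hmin⟩ := Finset.exists_min_image
      (Finset.univ.filter fun z => z ≠ x ∧ pos k₁ < pos z) pos ⟨k₂, by simp [h₂.ne, hlt]⟩
    simp only [Finset.mem_filter, Finset.mem_univ, true_and, and_imp] at hk' hmin
    have hk'₂ := hmin k₂ h₂.ne hlt
    obtain ⟨w', htop', he', hd⟩ := h₁.exists_shift hT hpos hconv he₁ hk'.1 hk'.2 hmin
    have := ih _ (by omega) htop' he' hk'₂ rfl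
    refine (rankingDist_triangle hT w₁ w' w₂).trans ((add_le_add hd this).trans ?_)
    norm_cast
    omega

theorem TopTwo.rankingDist_le (hT : ∀ I ∈ T, I.Nonempty) {x k₁ k₂ : V} {pos : V → ℤ}
    (hpos : Function.Injective pos) (hconv : ConvexAvoiding T x pos) {w₁ w₂ : V ↪ ℝ}
    (h₁ : TopTwo w₁ x k₁) (h₂ : TopTwo w₂ x k₂)
    (he₁ : blockedElements x pos w₁ = ∅) (he₂ : blockedElements x pos w₂ = ∅) :
    rankingDist hT w₁ w₂ ≤ (pos k₁ - pos k₂).natAbs := by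
  rcases le_total (pos k₁) (pos k₂) with h | h
  · refine (h₁.rankingDist_le_of_le hT hpos hconv h₂ he₁ he₂ h).trans ?_
    norm_cast
    omega
  · rw [rankingDist_comm]
    refine (h₂.rankingDist_le_of_le hT hpos hconv h₁ he₂ he₁ h).trans ?_
    norm_cast
    omega

/-- The number of steps that bring `x` to the top and leave no blocked element. -/
noncomputable def straighteningCost (T : Finset (Finset V)) (pos : V → ℤ) (w : V ↪ ℝ) (x : V) : ℕ :=
  (dominators T w x).card + (blockedElements x pos w).card

theorem exists_straightening (hT : ∀ I ∈ T, I.Nonempty) {x k : V} {pos : V → ℤ}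
    (hpos : Function.Injective pos) (hconv : ConvexAvoiding T x pos) {w : V ↪ ℝ}
    (hk : k ≠ x) (hmax : ∀ z, z ≠ x → w z ≤ w k) :
    ∃ w' : V ↪ ℝ, TopTwo w' x k ∧ blockedElements x pos w' = ∅ ∧
      rankingDist hT w w' ≤ straighteningCost T pos w x := by
  obtain ⟨w₁, h₁, h₂, hd⟩ := exists_raise_to_top hT w x
  have htop : TopTwo w₁ x k := ⟨hk, h₁, fun z hz => by rw [h₂ z hz, h₂ k hk]; exact hmax z hz⟩
  obtain ⟨w', htop', he', hd'⟩ := exists_blockedElements_eq_empty hT hpos hconv htop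
  rw [blockedElements_congr pos h₂] at hd'
  refine ⟨w', htop', he', (rankingDist_triangle hT w w₁ w').trans ((add_le_add hd hd').trans ?_)⟩
  rw [straighteningCost, Nat.cast_add]

theorem rankingDist_le_straighteningCost (hT : ∀ I ∈ T, I.Nonempty) {x k₁ k₂ : V} {pos : V → ℤ}
    (hpos : Function.Injective pos) (hconv : ConvexAvoiding T x pos) {w₁ w₂ : V ↪ ℝ}
    (hk₁ : k₁ ≠ x) (hmax₁ : ∀ z, z ≠ x → w₁ z ≤ w₁ k₁)
    (hk₂ : k₂ ≠ x) (hmax₂ : ∀ z, z ≠ x → w₂ z ≤ w₂ k₂) :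
    rankingDist hT w₁ w₂ ≤ (straighteningCost T pos w₁ x + straighteningCost T pos w₂ x +
      (pos k₁ - pos k₂).natAbs : ℕ) := by
  obtain ⟨w₁', h₁, he₁, hd₁⟩ := exists_straightening hT hpos hconv hk₁ hmax₁
  obtain ⟨w₂', h₂, he₂, hd₂⟩ := exists_straightening hT hpos hconv hk₂ hmax₂
  have hd := h₁.rankingDist_le hT hpos hconv h₂ he₁ he₂
  rw [rankingDist_comm] at hd₂
  refine (rankingDist_triangle hT w₁ w₁' w₂).trans
    ((add_le_add hd₁ ((rankingDist_triangle hT w₁' w₂' w₂).trans (add_le_add hd hd₂))).trans ?_)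
  norm_cast
  omega

end Linearized

theorem SimpleGraph.Reachable.induct_of_adj {V : Type*} {G : SimpleGraph V} {u v : V}
    (h : G.Reachable u v) {p : V → Prop} (hp : ∀ a b, G.Adj a b → p a → p b) (hu : p u) : p v := by
  obtain ⟨q⟩ := h
  induction q with
  | nil => exact hu
  | cons hadj _ ih => exact ih (hp _ _ hadj hu)

/-! ### The cycle: cyclic positions, double counting and averaging -/

section Cycle

variable {d : ℕ}

/-- The position of `v` when the cycle is cut open at `x`. -/
def cyclicPos (x v : Fin (d + 1)) : ℤ := ((v - x : Fin (d + 1)) : ℕ)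

/-- Turns statements about cyclic order into linear arithmetic within the reach of `omega`. -/
theorem cyclicPos_cases (x v : Fin (d + 1)) :
    (x : ℕ) ≤ v ∧ cyclicPos x v = (v : ℕ) - (x : ℕ) ∨
      (v : ℕ) < x ∧ cyclicPos x v = (v : ℕ) + (d + 1) - (x : ℕ) := by
  have hx := x.2
  have hv := v.2
  rw [cyclicPos, Fin.val_sub]
  rcases le_or_gt (x : ℕ) v with h | h
  · left
    have : d + 1 - (x : ℕ) + v = (v - x) + (d + 1) := by omega
    rw [this, Nat.add_mod_right, Nat.mod_eq_of_lt (by omega)]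
    omega
  · right
    rw [Nat.mod_eq_of_lt (by omega)]
    omega

theorem cyclicPos_injective (x : Fin (d + 1)) : Function.Injective (cyclicPos x) := fun a b h => by
  have := cyclicPos_cases x a
  have := cyclicPos_cases x b
  have := a.2
  have := b.2
  ext
  omega

theorem mem_graphTubes {V : Type*} [Fintype V] {G : SimpleGraph V} {I : Finset V} :
    I ∈ graphTubes G ↔ (G.induce (I : Set V)).Connected := by
  simp [graphTubes]

theorem graphTubes_nonempty {V : Type*} [Fintype V] (G : SimpleGraph V) :
    ∀ I ∈ graphTubes G, I.Nonempty := fun I hI => by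
  obtain ⟨i⟩ := (mem_graphTubes.1 hI).nonempty
  exact ⟨i.1, i.2⟩

theorem cyclicPos_of_cycleGraph_adj {u v : Fin (d + 1)}
    (h : (SimpleGraph.cycleGraph (d + 1)).Adj u v) : cyclicPos u v = 1 ∨ cyclicPos v u = 1 := by
  cases d with
  | zero => simp [SimpleGraph.cycleGraph_one_eq_bot] at h
  | succ d =>
    rw [SimpleGraph.cycleGraph_adj] at h
    rcases h with h | h
    · right
      simp [cyclicPos, h]
    · left
      simp [cyclicPos, h]

/-- The edge entering `x` is excluded because the cut breaks it. -/
theorem cyclicPos_eq_add_one {u v x : Fin (d + 1)} (h : cyclicPos u v = 1) (hv : v ≠ x) :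
    cyclicPos x v = cyclicPos x u + 1 := by
  have := cyclicPos_cases u v
  have := cyclicPos_cases x u
  have := cyclicPos_cases x v
  have := Fin.val_ne_of_ne hv
  omega

/-- Away from `x` the cycle is a path: a walk inside `I` changes the position by one at each step,
so it cannot jump over a missing `c`. -/
theorem convexAvoiding_cyclicPos (x : Fin (d + 1)) :
    ConvexAvoiding (graphTubes (SimpleGraph.cycleGraph (d + 1))) x (cyclicPos x) := by
  intro I hI hx a ha b hb c hac hcb
  by_contra hc
  have hreach := (mem_graphTubes.1 hI).preconnected ⟨a, ha⟩ ⟨b, hb⟩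
  refine (hreach.induct_of_adj (p := fun z => cyclicPos x z.1 < cyclicPos x c) ?_ hac).not_gt hcb
  rintro ⟨y, hy⟩ ⟨z, hz⟩ hadj hlt
  have hadj' : (SimpleGraph.cycleGraph (d + 1)).Adj y z := hadj
  have hzc : cyclicPos x z ≠ cyclicPos x c :=
    (cyclicPos_injective x).ne (ne_of_mem_of_not_mem hz hc)
  change cyclicPos x y < cyclicPos x c at hlt
  change cyclicPos x z < cyclicPos x c
  rcases cyclicPos_of_cycleGraph_adj hadj' with h | h
  · have := cyclicPos_eq_add_one h (ne_of_mem_of_not_mem hz hx)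
    omega
  · have := cyclicPos_eq_add_one h (ne_of_mem_of_not_mem hy hx)
    omega

/-- If `v` tops a tube containing `x`, that tube joins `v` to `x` along one side and so contains
everything between them there; hence no larger element lies on that side. This disjointness lets
each `v` count at most once in the cost at `x`. -/
theorem disjoint_dominators_blockedElements (w : Fin (d + 1) ↪ ℝ) (x : Fin (d + 1)) :
    Disjoint (dominators (graphTubes (SimpleGraph.cycleGraph (d + 1))) w x)
      (blockedElements x (cyclicPos x) w) := by
  rw [Finset.disjoint_left]
  intro v hv hb
  obtain ⟨hxv, I, hI, hxI, hvI, hmax⟩ := mem_dominators.1 hv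
  obtain ⟨hvx, ⟨u₁, hu₁x, hu₁, hlt₁⟩, ⟨u₂, hu₂x, hu₂, hlt₂⟩⟩ := mem_blockedElements.1 hb
  have hu₁I : u₁ ∉ I := fun h => (hmax _ h).not_gt hlt₁
  have hu₂I : u₂ ∉ I := fun h => (hmax _ h).not_gt hlt₂
  have h₁ : (u₁ : ℕ) ≠ x := Fin.val_ne_of_ne hu₁x
  have := cyclicPos_cases x v
  have := cyclicPos_cases x u₁
  have := cyclicPos_cases x u₂
  have := cyclicPos_cases u₁ v
  have := cyclicPos_cases u₁ u₂
  have := cyclicPos_cases u₁ x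
  have := u₁.2
  have := u₂.2
  have := x.2
  have := v.2
  -- Cut at `u₁` instead of `x`: the tube avoids `u₁`, and `u₂` lies between `v` and `x`.
  exact hu₂I (convexAvoiding_cyclicPos u₁ I hI hu₁I v hvI x hxI u₂ (by omega) (by omega))

/-- The elements that contribute to the straightening cost at `x`. -/
noncomputable def costElements (w : Fin (d + 1) ↪ ℝ) (x : Fin (d + 1)) : Finset (Fin (d + 1)) :=
  dominators (graphTubes (SimpleGraph.cycleGraph (d + 1))) w x ∪ blockedElements x (cyclicPos x) w

theorem card_costElements (w : Fin (d + 1) ↪ ℝ) (x : Fin (d + 1)) :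
    (costElements w x).card =
      straighteningCost (graphTubes (SimpleGraph.cycleGraph (d + 1))) (cyclicPos x) w x := by
  rw [costElements, Finset.card_union_of_disjoint (disjoint_dominators_blockedElements w x),
    straighteningCost]

theorem self_notMem_costElements (w : Fin (d + 1) ↪ ℝ) (x : Fin (d + 1)) :
    x ∉ costElements w x := by
  simp [costElements, mem_dominators, mem_blockedElements]

theorem notMem_costElements {w : Fin (d + 1) ↪ ℝ} {v x : Fin (d + 1)} (hx : w v < w x)
    (h : (∀ u, u ≠ x → cyclicPos x u < cyclicPos x v → w u ≤ w v) ∨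
      ∀ u, u ≠ x → cyclicPos x v < cyclicPos x u → w u ≤ w v) : v ∉ costElements w x := by
  rw [costElements, Finset.mem_union, mem_dominators, mem_blockedElements]
  rintro (⟨h', -⟩ | ⟨-, ⟨u₁, hu₁, hp₁, hw₁⟩, ⟨u₂, hu₂, hp₂, hw₂⟩⟩)
  · exact hx.not_gt h'
  · rcases h with h | h
    · exact (h u₁ hu₁ hp₁).not_gt hw₁
    · exact (h u₂ hu₂ hp₂).not_gt hw₂

/-- The nearest elements larger than `v` on both sides contribute nothing. -/
theorem exists_notMem_costElements {w : Fin (d + 1) ↪ ℝ} {v z : Fin (d + 1)} (hz : w v < w z) :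
    ∃ x x', w v < w x ∧ w v < w x' ∧ v ∉ costElements w x ∧ v ∉ costElements w x' ∧
      (x = x' → ∀ u, w v < w u → u = x) := by
  classical
  have hne : (Finset.univ.filter fun x => w v < w x).Nonempty := ⟨z, by simpa using hz⟩
  -- `cyclicPos x v` is the distance forward from `x` to `v`: its minimizer is the nearest larger
  -- element before `v`, its maximizer the nearest one after `v`.
  obtain ⟨x, hx, hmin⟩ := Finset.exists_min_image _ (fun x => cyclicPos x v) hne
  obtain ⟨x', hx', hmax⟩ := Finset.exists_max_image _ (fun x => cyclicPos x v) hne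
  simp only [Finset.mem_filter, Finset.mem_univ, true_and] at hx hx' hmin hmax
  have h₁ : ∀ u, u ≠ x → cyclicPos x u < cyclicPos x v → w u ≤ w v := fun u hu hlt => by
    by_contra hwu
    have := hmin u (not_le.1 hwu)
    have := Fin.val_ne_of_ne hu
    have := cyclicPos_cases x u
    have := cyclicPos_cases x v
    have := cyclicPos_cases u v
    omega
  have h₂ : ∀ u, u ≠ x' → cyclicPos x' v < cyclicPos x' u → w u ≤ w v := fun u hu hlt => by
    by_contra hwu
    have := hmax u (not_le.1 hwu)
    have := Fin.val_ne_of_ne hu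
    have := cyclicPos_cases x' u
    have := cyclicPos_cases x' v
    have := cyclicPos_cases u v
    omega
  refine ⟨x, x', hx, hx', notMem_costElements hx (Or.inl h₁), notMem_costElements hx' (Or.inr h₂),
    fun he u hu => ?_⟩
  subst he
  by_contra hux
  rcases lt_trichotomy (cyclicPos x u) (cyclicPos x v) with h | h | h
  · exact (h₁ u hux h).not_gt hu
  · exact hu.ne (by rw [cyclicPos_injective x h])
  · exact (h₂ u hux h).not_gt hu

/-- Among the `d + 1` cuts, `v` is free at itself and at its nearest larger elements on both sides,
leaving `d - 2`. The two corrections are for the top element `y`, which has no larger element, and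
for `k`, which has only one. -/
theorem card_filter_mem_costElements_add (w : Fin (d + 1) ↪ ℝ) {y k : Fin (d + 1)}
    (htop : TopTwo w y k) (v : Fin (d + 1)) :
    (Finset.univ.filter fun x => v ∈ costElements w x).card + 2 ≤
      d + (if v = y then 2 else 0) + (if v = k then 1 else 0) := by
  have hcard : ∀ S : Finset (Fin (d + 1)), (∀ x ∈ S, v ∉ costElements w x) →
      (Finset.univ.filter fun x => v ∈ costElements w x).card + S.card ≤ d + 1 := fun S hS => by
    rw [← Finset.card_union_of_disjoint]
    · simpa using Finset.card_le_univ ((Finset.univ.filter fun x => v ∈ costElements w x) ∪ S)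
    · rw [Finset.disjoint_left]
      intro x hx hxS
      exact hS x hxS (Finset.mem_filter.1 hx).2
  by_cases hvy : v = y
  · have := hcard {v} (by simpa using self_notMem_costElements w v)
    rw [Finset.card_singleton] at this
    rw [if_pos hvy]
    omega
  · have hlt : w v < w y := lt_of_le_of_ne (htop.le_fst v) (w.injective.ne hvy)
    obtain ⟨x, x', hx, hx', hn, hn', huniq⟩ := exists_notMem_costElements hlt
    have hvx : v ≠ x := fun e => hx.ne (by rw [e])
    have hvx' : v ≠ x' := fun e => hx'.ne (by rw [e])
    by_cases hxx : x = x'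
    · have hvk : v = k := by
        by_contra hvk
        have hlt' : w v < w k := lt_of_le_of_ne (htop.le_snd v hvy) (w.injective.ne hvk)
        exact htop.ne ((huniq hxx k hlt').trans (huniq hxx y hlt).symm)
      have := hcard {v, x} (by simp [self_notMem_costElements w v, hn])
      rw [Finset.card_pair hvx] at this
      rw [if_pos hvk]
      omega
    · have := hcard {v, x, x'} (by simp [self_notMem_costElements w v, hn, hn'])
      rw [Finset.card_eq_three.2 ⟨v, x, x', hvx, hvx', hxx, rfl⟩] at this
      omega

theorem exists_max_ne (hd : 0 < d) (w : Fin (d + 1) ↪ ℝ) (x : Fin (d + 1)) :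
    ∃ k, k ≠ x ∧ ∀ z, z ≠ x → w z ≤ w k := by
  have : Nontrivial (Fin (d + 1)) := Fin.nontrivial_iff_two_le.2 (by omega)
  obtain ⟨z, hz⟩ := exists_ne x
  obtain ⟨k, hk, hmax⟩ := Finset.exists_max_image (Finset.univ.filter fun z => z ≠ x) w
    ⟨z, by simpa using hz⟩
  exact ⟨k, (Finset.mem_filter.1 hk).2, fun z hz => hmax z (by simpa using hz)⟩

/-- Double counting of the pairs `(x, v)` with `v ∈ costElements w x`; the corrections for `y` and
`k` add up to 3. -/
theorem sum_straighteningCost_le (hd : 0 < d) (w : Fin (d + 1) ↪ ℝ) :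
    ∑ x, straighteningCost (graphTubes (SimpleGraph.cycleGraph (d + 1))) (cyclicPos x) w x + 2 * d
      ≤ (d + 1) * d + 1 := by
  obtain ⟨y, -, hy⟩ := Finset.exists_max_image Finset.univ w Finset.univ_nonempty
  obtain ⟨k, hky, hk⟩ := exists_max_ne hd w y
  have htop : TopTwo w y k := ⟨hky, fun z => hy z (Finset.mem_univ z), hk⟩
  have hsum := Finset.sum_le_sum fun v (_ : v ∈ Finset.univ) =>
    card_filter_mem_costElements_add w htop v
  simp only [Finset.sum_add_distrib, Finset.sum_const, Finset.card_univ, Fintype.card_fin,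
    smul_eq_mul, Finset.sum_ite_eq', Finset.mem_univ, if_true] at hsum
  have hcomm : ∑ x, (costElements w x).card =
      ∑ v, (Finset.univ.filter fun x => v ∈ costElements w x).card := by
    simp only [Finset.card_filter]
    rw [Finset.sum_comm]
    refine Finset.sum_congr rfl fun x _ => ?_
    simp
  rw [← hcomm] at hsum
  simp only [card_costElements] at hsum
  omega

/-- With `δ = b - a`, the `δ` cuts in `(a, b]` see the complementary arc, of length `d + 1 - δ`, and
the other `d + 1 - δ` cuts see the arc of length `δ`. -/
theorem sum_natAbs_cyclicPos_sub_of_le {a b : Fin (d + 1)} (hab : a ≤ b) :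
    (∑ x, ((cyclicPos x a - cyclicPos x b).natAbs : ℤ)) =
      2 * (((b : ℕ) : ℤ) - (a : ℕ)) * (d + 1 - (((b : ℕ) : ℤ) - (a : ℕ))) := by
  have hterm : ∀ x, ((cyclicPos x a - cyclicPos x b).natAbs : ℤ) =
      if x ∈ Finset.Ioc a b then (d + 1 - (((b : ℕ) : ℤ) - (a : ℕ))) else
        (((b : ℕ) : ℤ) - (a : ℕ)) := fun x => by
    have := cyclicPos_cases x a
    have := cyclicPos_cases x b
    have := a.2
    have := b.2
    have : (a : ℕ) ≤ b := hab
    simp only [Finset.mem_Ioc, Fin.lt_def, Fin.le_def]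
    split_ifs <;> omega
  rw [Finset.sum_congr rfl fun x _ => hterm x, Finset.sum_ite]
  have h₁ : (Finset.univ.filter fun x => x ∈ Finset.Ioc a b) = Finset.Ioc a b := by
    ext
    simp
  have h₂ : ((Finset.univ.filter fun x => x ∉ Finset.Ioc a b).card : ℤ) =
      d + 1 - (((b : ℕ) : ℤ) - (a : ℕ)) := by
    have := Finset.card_filter_add_card_filter_not (s := Finset.univ) (fun x => x ∈ Finset.Ioc a b)
    rw [h₁, Fin.card_Ioc, Finset.card_univ, Fintype.card_fin] at this
    have : (a : ℕ) ≤ b := hab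
    omega
  have h₃ : (((b : ℕ) - (a : ℕ) : ℕ) : ℤ) = ((b : ℕ) : ℤ) - (a : ℕ) := by
    have : (a : ℕ) ≤ b := hab
    omega
  rw [h₁, Finset.sum_const, Finset.sum_const, Fin.card_Ioc, nsmul_eq_mul, nsmul_eq_mul, h₂, h₃]
  ring

theorem sum_natAbs_cyclicPos_sub_le (a b : Fin (d + 1)) :
    2 * (∑ x, ((cyclicPos x a - cyclicPos x b).natAbs : ℤ)) ≤ (d + 1) ^ 2 := by
  rcases le_total a b with h | h
  · rw [sum_natAbs_cyclicPos_sub_of_le h]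
    nlinarith [sq_nonneg (2 * (((b : ℕ) : ℤ) - (a : ℕ)) - (d + 1))]
  · have : ∀ x, (cyclicPos x a - cyclicPos x b).natAbs = (cyclicPos x b - cyclicPos x a).natAbs :=
      fun x => by omega
    simp only [this]
    rw [sum_natAbs_cyclicPos_sub_of_le h]
    nlinarith [sq_nonneg (2 * (((a : ℕ) : ℤ) - (b : ℕ)) - (d + 1))]

/-- The total distance between the positions of the second elements. -/
theorem sum_natAbs_cyclicPos_snd_sub_le (hd : 0 < d) {w₁ w₂ : Fin (d + 1) ↪ ℝ}
    {k₁ k₂ : Fin (d + 1) → Fin (d + 1)}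
    (hk₁ : ∀ x, k₁ x ≠ x) (hmax₁ : ∀ x z, z ≠ x → w₁ z ≤ w₁ (k₁ x))
    (hk₂ : ∀ x, k₂ x ≠ x) (hmax₂ : ∀ x z, z ≠ x → w₂ z ≤ w₂ (k₂ x)) :
    2 * (∑ x, ((cyclicPos x (k₁ x) - cyclicPos x (k₂ x)).natAbs : ℤ)) ≤ d ^ 2 + 4 * d - 5 := by
  obtain ⟨y₁, -, hy₁⟩ := Finset.exists_max_image Finset.univ w₁ Finset.univ_nonempty
  obtain ⟨y₂, -, hy₂⟩ := Finset.exists_max_image Finset.univ w₂ Finset.univ_nonempty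
  -- The second element is the overall top unless the cut is made at that top, so only the cuts at
  -- `y₁` and `y₂` are exceptional.
  have hky₁ : ∀ x, x ≠ y₁ → k₁ x = y₁ := fun x hx =>
    w₁.injective (le_antisymm (hy₁ _ (Finset.mem_univ _)) (hmax₁ x y₁ hx.symm))
  have hky₂ : ∀ x, x ≠ y₂ → k₂ x = y₂ := fun x hx =>
    w₂.injective (le_antisymm (hy₂ _ (Finset.mem_univ _)) (hmax₂ x y₂ hx.symm))
  have hrange : ∀ x, 1 ≤ cyclicPos x (k₁ x) ∧ cyclicPos x (k₁ x) ≤ d ∧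
      1 ≤ cyclicPos x (k₂ x) ∧ cyclicPos x (k₂ x) ≤ d := fun x => by
    have := Fin.val_ne_of_ne (hk₁ x)
    have := Fin.val_ne_of_ne (hk₂ x)
    have := cyclicPos_cases x (k₁ x)
    have := cyclicPos_cases x (k₂ x)
    have := (k₁ x).2
    have := (k₂ x).2
    have := x.2
    omega
  by_cases hy : y₁ = y₂
  · subst hy
    have hterm : ∀ x ∈ Finset.univ, ((cyclicPos x (k₁ x) - cyclicPos x (k₂ x)).natAbs : ℤ) ≤
        if x = y₁ then (d - 1 : ℤ) else 0 := fun x _ => by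
      split_ifs with hx
      · have := hrange x
        omega
      · rw [hky₁ x hx, hky₂ x hx]
        omega
    have := Finset.sum_le_sum hterm
    rw [Finset.sum_ite_eq' Finset.univ y₁, if_pos (Finset.mem_univ _)] at this
    have : (1 : ℤ) ≤ d := by exact_mod_cast hd
    nlinarith
  -- At the cut `y₁` the second element of `w₁` is unknown, but both positions lie in `[1, d]`, so
  -- the gap is at most `d - 1`; the correction replaces `cyclicPos y₁ y₂` by this bound. The cut
  -- `y₂` is symmetric.
  · have hterm : ∀ x ∈ Finset.univ, ((cyclicPos x (k₁ x) - cyclicPos x (k₂ x)).natAbs : ℤ) ≤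
        ((cyclicPos x y₁ - cyclicPos x y₂).natAbs : ℤ) +
          (if x = y₁ then (d - 1 - cyclicPos y₁ y₂ : ℤ) else 0) +
          (if x = y₂ then (d - 1 - cyclicPos y₂ y₁ : ℤ) else 0) := fun x _ => by
      have hr := hrange x
      by_cases hx₁ : x = y₁
      · subst hx₁
        have hk := hky₂ x hy
        have := cyclicPos_cases x x
        rw [if_pos rfl, if_neg hy]
        rw [hk] at hr ⊢
        omega
      · by_cases hx₂ : x = y₂
        · subst hx₂
          have hk := hky₁ x hx₁
          have := cyclicPos_cases x x
          rw [if_neg hx₁, if_pos rfl]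
          rw [hk] at hr ⊢
          omega
        · rw [if_neg hx₁, if_neg hx₂, hky₁ x hx₁, hky₂ x hx₂]
          omega
    have hs := Finset.sum_le_sum hterm
    rw [Finset.sum_add_distrib, Finset.sum_add_distrib, Finset.sum_ite_eq' Finset.univ y₁,
      Finset.sum_ite_eq' Finset.univ y₂, if_pos (Finset.mem_univ _),
      if_pos (Finset.mem_univ _)] at hs
    have hsum := sum_natAbs_cyclicPos_sub_le y₁ y₂
    -- The two arcs make up the whole cycle, so the corrections total `2(d - 1) - (d + 1) = d - 3`.
    have hadd : cyclicPos y₁ y₂ + cyclicPos y₂ y₁ = d + 1 := by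
      have := Fin.val_ne_of_ne hy
      have := cyclicPos_cases y₁ y₂
      have := cyclicPos_cases y₂ y₁
      omega
    nlinarith

theorem rankingDist_cycleGraph_le (hd : 0 < d) (w₁ w₂ : Fin (d + 1) ↪ ℝ) {M : ℕ}
    (hM : 5 * d ≤ 2 * M + 4) :
    rankingDist (graphTubes_nonempty (SimpleGraph.cycleGraph (d + 1))) w₁ w₂ ≤ M := by
  choose k₁ hk₁ hmax₁ using exists_max_ne hd w₁
  choose k₂ hk₂ hmax₂ using exists_max_ne hd w₂
  set T := graphTubes (SimpleGraph.cycleGraph (d + 1)) with hT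
  set c : Fin (d + 1) → ℕ := fun x => straighteningCost T (cyclicPos x) w₁ x +
    straighteningCost T (cyclicPos x) w₂ x + (cyclicPos x (k₁ x) - cyclicPos x (k₂ x)).natAbs with hc
  have hdist : ∀ x, rankingDist (graphTubes_nonempty _) w₁ w₂ ≤ c x := fun x =>
    rankingDist_le_straighteningCost (graphTubes_nonempty _) (cyclicPos_injective x)
      (convexAvoiding_cyclicPos x) (hk₁ x) (hmax₁ x) (hk₂ x) (hmax₂ x)
  -- Comparing with `M + 1` rather than `M` suffices because the costs are integers; twice the left
  -- side is at most `5d² - 1`, and twice the right side is at least `(d + 1)(5d - 2)`.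
  have hsum : ∑ x, c x < ∑ _x : Fin (d + 1), (M + 1) := by
    have h₁ := sum_straighteningCost_le hd w₁
    have h₂ := sum_straighteningCost_le hd w₂
    have h₃ := sum_natAbs_cyclicPos_snd_sub_le hd hk₁ hmax₁ hk₂ hmax₂
    simp only [hc, Finset.sum_add_distrib, Finset.sum_const, Finset.card_univ, Fintype.card_fin,
      smul_eq_mul]
    rw [← hT] at h₁ h₂
    zify at h₁ h₂ h₃ hM hd ⊢
    nlinarith [mul_le_mul_of_nonneg_left hM (by positivity : (0 : ℤ) ≤ (d : ℤ) + 1)]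
  obtain ⟨x, -, hx⟩ := Finset.exists_lt_of_sum_lt hsum
  refine (hdist x).trans ?_
  exact_mod_cast Nat.lt_succ_iff.1 hx

theorem isPolytope_standardCyclohedron (d : ℕ) : IsPolytope (standardCyclohedron d) :=
  isPolytope_simplexSum (graphTubes (SimpleGraph.cycleGraph (d + 1)))

theorem ediam_standardCyclohedron_le (hd : 0 < d) {M : ℕ} (hM : 5 * d ≤ 2 * M + 4) :
    (polytopeGraph (standardCyclohedron d)).ediam ≤ M := by
  refine SimpleGraph.ediam_le_of_edist_le fun u v => ?_
  have hT := graphTubes_nonempty (SimpleGraph.cycleGraph (d + 1))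
  obtain ⟨w₁, rfl⟩ := exists_rankingVertex_eq hT u
  obtain ⟨w₂, rfl⟩ := exists_rankingVertex_eq hT v
  exact rankingDist_cycleGraph_le hd w₁ w₂ hM

end Cycle

/-! ### Transfer to an arbitrary realization -/

theorem mainTheorem5 (d : ℕ) (hd : 0 < d)
    {E : Type*} [NormedAddCommGroup E] [NormedSpace ℝ E] [FiniteDimensional ℝ E]
    (P : Set E) (hP : IsCyclohedron d P) :
    (polytopeGraph P).ediam ≠ ⊤ ∧
      ((polytopeGraph P).diam : ℤ) ≤ ⌈(5 * (d : ℝ) / 2 : ℝ)⌉ - 2 := by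
  obtain ⟨f⟩ := hP.2.nonempty_graphIso hP.1 (isPolytope_standardCyclohedron d)
  have hM : ∃ M : ℕ, (M : ℤ) = ⌈(5 * (d : ℝ) / 2 : ℝ)⌉ - 2 := by
    refine ⟨(⌈(5 * (d : ℝ) / 2 : ℝ)⌉ - 2).toNat, Int.toNat_of_nonneg ?_⟩
    have h : (2 : ℝ) < 5 * (d : ℝ) / 2 := by
      have : (1 : ℝ) ≤ d := by exact_mod_cast hd
      linarith
    have : (2 : ℤ) < ⌈(5 * (d : ℝ) / 2 : ℝ)⌉ := Int.lt_ceil.2 (by exact_mod_cast h)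
    omega
  obtain ⟨M, hM⟩ := hM
  have hM' : 5 * d ≤ 2 * M + 4 := by
    have h := Int.le_ceil (5 * (d : ℝ) / 2 : ℝ)
    have h' : ⌈(5 * (d : ℝ) / 2 : ℝ)⌉ = (M : ℤ) + 2 := by omega
    rw [h'] at h
    push_cast at h
    have : (5 * d : ℝ) ≤ 2 * M + 4 := by linarith
    exact_mod_cast this
  -- Bounding the extended diameter by a natural number gives finiteness together with the bound on
  -- `diam`.
  have hle : (polytopeGraph P).ediam ≤ M := f.ediam_le.trans (ediam_standardCyclohedron_le hd hM')
  refine ⟨fun h => ?_, ?_⟩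
  · rw [h] at hle
    exact ENat.natCast_ne_top M (top_le_iff.1 hle)
  · rw [← hM, Nat.cast_le]
    exact ENat.toNat_le_of_le_natCast hle
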